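/- Let $k\ge 2$ be an integer and $p$ an integer with $\gcd(|p|,k)=1$. Let $A,A_0\ge 0$, and let $(a_\nu),(b_\mu),(c_\nu),(d_\mu)$ be four (empty, finite or infinite) families of positive reals with $\sum 1/a_\nu$, $\sum 1/b_\mu$, $\sum 1/c_\nu$, $\sum 1/d_\mu$ convergent. Put $$G(z)=z^{p}\,e^{Az^k+A_0z^{-k}}\cdot\frac{\prod_{\nu}\left(1+\frac{z^k}{a_\nu}\right)}{\prod_{\mu}\left(1-\frac{z^k}{b_\mu}\right)}\cdot\frac{\prod_{\nu}\left(1+\frac{z^{-k}}{c_\nu}\right)}{\prod_{\mu}\left(1-\frac{z^{-k}}{d_\mu}\right)},$$ and assume $G(z)\not\equiv z^p$. Let $\alpha\in\mathbb C$ with $\operatorname{Im}\alpha^k\ne 0$. An $\alpha$-point of $G$ is a solution $z$ of $G(z)=\alpha$; it is simple if $G$ is holomorphic near $z$ and $G'(z)\neq 0$. For $s\in\mathbb Z$ let $$Q_s=\left\{z\in\mathbb C\setminus\{0\}: 0<\operatorname{Arg}\left(z e^{-i\pi s/k}\right)<\tfrac{\pi}{k}\right\},$$ where $\operatorname{Arg}$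 is the principal argument, with values in $(-\pi,\pi]$. (1) Every $\alpha$-point $z$ of $G$ is simple and satisfies $\operatorname{Im} z^k\ne 0$, and no other $\alpha$-point of $G$ has the same absolute value: if $G(z)=G(z')=\alpha$ and $|z|=|z'|$, then $z=z'$. (2) Let $z_i,z_{i+1}$ be two consecutive $\alpha$-points, that is, $G(z_i)=G(z_{i+1})=\alpha$, $|z_i|<|z_{i+1}|$ and no $\alpha$-point $\zeta$ satisfies $|z_i|<|\zeta|<|z_{i+1}|$. If $\alpha\in Q_{2q-\varkappa}$ and $z_i\in Q_{2m-\sigma}$ with $q,m\in\mathbb Z$ and $\varkappa,\sigma\in\{0,1\}$, then the congruence $$p(l+m)\equiv 2q+1-\varkappa-\sigma\pmod k$$ has an integer solution $l$, and $z_{i+1}\in Q_{2l-1+\sigma}$ for every such solution $l$. -/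

import Mathlib

noncomputable section

/-- The generating function (without power and constant factor) of a (doubly infinite) totally
positive sequence:
`R(w) = e^{A w + A₀ / w} ∏ (1 + w/a_ν) / ∏ (1 - w/b_μ) * ∏ (1 + w⁻¹/c_ν) / ∏ (1 - w⁻¹/d_μ)`.
Each of the four families has its own index type, so that every product may be empty, finite or
infinite. At `w = 0` and at the poles of `R` the value in Lean carries no meaning. -/
def genFun {ι₁ ι₂ ι₃ ι₄ : Type*} (A A₀ : ℝ) (a : ι₁ → ℝ) (b : ι₂ → ℝ) (c : ι₃ → ℝ) (d : ι₄ → ℝ)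
    (w : ℂ) : ℂ :=
  Complex.exp ((A : ℂ) * w + (A₀ : ℂ) * w⁻¹) *
    ((∏' ν, (1 + w / (a ν : ℂ))) / (∏' μ, (1 - w / (b μ : ℂ)))) *
    ((∏' ν, (1 + w⁻¹ / (c ν : ℂ))) / (∏' μ, (1 - w⁻¹ / (d μ : ℂ))))

/-- The function `G(z) = z^p R(z^k)`. In Lean, `G` takes the value `0` at its poles and (when
`p ≠ 0`) at the origin, so for `α ≠ 0` no such point is a solution of `G(z) = α`. -/
def powComp {ι₁ ι₂ ι₃ ι₄ : Type*} (p : ℤ) (k : ℕ) (A A₀ : ℝ)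
    (a : ι₁ → ℝ) (b : ι₂ → ℝ) (c : ι₃ → ℝ) (d : ι₄ → ℝ) (z : ℂ) : ℂ :=
  z ^ p * genFun A A₀ a b c d (z ^ k)

/-- The `α`-set of a function. -/
def alphaSet (f : ℂ → ℂ) (α : ℂ) : Set ℂ := {z | f z = α}

/-- `z` is an `α`-point of `f` of multiplicity `n ≥ 1`: `f` is holomorphic near `z`, `f z = α`,
`f'(z) = ⋯ = f^(n-1)(z) = 0` and `f^(n)(z) ≠ 0`. -/
def HasAlphaMultiplicity (f : ℂ → ℂ) (α z : ℂ) (n : ℕ) : Prop :=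
  1 ≤ n ∧ z ∈ alphaSet f α ∧ AnalyticAt ℂ f z ∧
    (∀ j, 1 ≤ j → j < n → iteratedDeriv j f z = 0) ∧ iteratedDeriv n f z ≠ 0

/-- A simple `α`-point: an `α`-point of multiplicity one. -/
def IsSimpleAlphaPoint (f : ℂ → ℂ) (α z : ℂ) : Prop := HasAlphaMultiplicity f α z 1

/-- `z` and `z'` are consecutive `α`-points in the order of increasing absolute value. -/
def ConsecutiveAlphaPoints (f : ℂ → ℂ) (α z z' : ℂ) : Prop :=
  z ∈ alphaSet f α ∧ z' ∈ alphaSet f α ∧ ‖z‖ < ‖z'‖ ∧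
    ∀ ζ ∈ alphaSet f α, ¬ (‖z‖ < ‖ζ‖ ∧ ‖ζ‖ < ‖z'‖)

/-- `e_m = exp(i π m / k)`. -/
def rootE (k : ℕ) (m : ℤ) : ℂ := Complex.exp (Complex.I * ((m : ℂ) / (k : ℂ) * (Real.pi : ℂ)))

/-- The open sector `Q_s = {z ≠ 0 : 0 < Arg (z e_{-s}) < π / k}`, `s ∈ ℤ`. -/
def sector (k : ℕ) (s : ℤ) : Set ℂ :=
  {z | z ≠ 0 ∧ 0 < Complex.arg (z * rootE k (-s)) ∧
    Complex.arg (z * rootE k (-s)) < Real.pi / (k : ℝ)}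

end

open Complex Filter Topology

/-! Put `w = z ^ k = exp u` with `u` in the strip `0 < Im u < π`. On the sector with index `m`, `G`
becomes `exp ((L u + 2π m p i) / k)` with one function `L u = p u + k log R(exp u)` for all sectors.
The logarithmic derivative `w R' / R` maps the upper half-plane into itself, so `Im L' > 0`, and
integration along segments carries this over to the difference quotients of `L` (`im_slope_pos`).
Hence `Re L` strictly decreases along vertical segments, and on a level set of `Re L` the value `Im
L` strictly increases with `Re u`, that is, with `|z|`.

The `α`-points with `Im z ^ k > 0` lie over the level set `Re L = k log |α|`, at the points where
`Im L` is in a fixed class mod `2π`. Conjugation turns those with `Im z ^ k < 0` into points over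
the same level set with `Im L` in the opposite class. Since `p` and `k` are coprime, each such point
of the strip carries exactly one `α`-point. The two classes are disjoint because `α ^ k` is not
real; this separates the absolute values.

The classes alternate, so the successor of an `α`-point lies in the other half-plane, and counting
multiples of `2π` gives the congruence (`exists_sector_next`). This needs that `Im L` skips no value
of the classes on the level set. A level curve can be interrupted only at the boundary of the strip,
where `exp L` is real, so only multiples of `π` can be lost (`exists_mem_level`). -/

/-- The canonical product `∏ (1 + z / a_ν)`. -/
noncomputable def facProd {ι : Type*} (a : ι → ℝ) (z : ℂ) : ℂ := ∏' ν, (1 + z / (a ν : ℂ))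

/-- The logarithm `∑ log (1 + z / a_ν)` of the canonical product off the real axis. -/
noncomputable def logSum {ι : Type*} (a : ι → ℝ) (z : ℂ) : ℂ := ∑' ν, log (1 + z / (a ν : ℂ))

/-! ### Canonical products and their logarithms off the real axis -/

section products

variable {ι : Type*} {a : ι → ℝ}

lemma summable_norm_div (hs : Summable fun ν => (a ν)⁻¹) (z : ℂ) :
    Summable fun ν => ‖z / (a ν : ℂ)‖ := by
  simpa [div_eq_mul_inv] using hs.abs.mul_left ‖z‖

lemma differentiable_facProd (hs : Summable fun ν => (a ν)⁻¹) :
    Differentiable ℂ (facProd a) := by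
  intro z
  have hU : IsOpen (Metric.ball (0 : ℂ) (‖z‖ + 1)) := Metric.isOpen_ball
  have h1 := Summable.hasProdLocallyUniformlyOn_one_add (f := fun ν (z : ℂ) => z / (a ν : ℂ)) hU
    (hs.abs.mul_left (‖z‖ + 1)) (Eventually.of_forall fun ν x hx => by
      have hx' : ‖x‖ ≤ ‖z‖ + 1 := by simpa using (mem_ball_zero_iff.mp hx).le
      rw [norm_div, norm_real, Real.norm_eq_abs, div_eq_mul_inv, abs_inv]
      gcongr) (fun ν => by fun_prop)
  have h2 := TendstoLocallyUniformlyOn.differentiableOn h1 (Eventually.of_forall fun s => by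
    fun_prop) hU
  exact (h2.differentiableAt (hU.mem_nhds (by simp)))

lemma facProd_conj (z : ℂ) :
    facProd a (starRingEnd ℂ z) = starRingEnd ℂ (facProd a z) := by
  unfold facProd
  have := Function.LeftInverse.map_tprod (L := .unconditional ι) (fun ν => 1 + z / (a ν : ℂ)) (g := starRingEnd ℂ)
    (g' := starRingEnd ℂ) continuous_conj continuous_conj (fun x => by simp)
  rw [this]
  simp

lemma facProd_ne_zero_of_pos (ha : ∀ ν, 0 < a ν) (hs : Summable fun ν => (a ν)⁻¹) {x : ℝ}
    (hx : 0 < x) : facProd a x ≠ 0 := by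
  refine tprod_one_add_ne_zero_of_summable (fun ν => ?_) (summable_norm_div hs _)
  have : 0 < 1 + x / a ν := by have := ha ν; positivity
  exact_mod_cast this.ne'

lemma one_add_div_im (r : ℝ) (z : ℂ) : (1 + z / (r : ℂ)).im = z.im / r := by
  simp [div_ofReal_im]

lemma one_add_div_im_ne_zero (ha : ∀ ν, 0 < a ν) {z : ℂ} (hz : z.im ≠ 0) (ν : ι) :
    (1 + z / (a ν : ℂ)).im ≠ 0 := by
  rw [one_add_div_im]
  exact div_ne_zero hz (ha ν).ne'

lemma exp_logSum (ha : ∀ ν, 0 < a ν) (hs : Summable fun ν => (a ν)⁻¹) {z : ℂ} (hz : z.im ≠ 0) :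
    exp (logSum a z) = facProd a z :=
  cexp_tsum_eq_tprod
    (fun ν h => one_add_div_im_ne_zero ha hz ν (by rw [h, zero_im]))
    (summable_log_one_add_of_summable (summable_norm_div hs z).of_norm)

/-- The distance from `0` to the segment `[1, 1 + ζ]` is at least `|sin (arg ζ)|`. -/
lemma norm_log_one_add_le_of_im_ne_zero {ζ : ℂ} (hζ : ζ.im ≠ 0) :
    ‖log (1 + ζ)‖ ≤ ‖ζ‖ ^ 2 / |ζ.im| := by
  have hn : 0 < ‖ζ‖ := norm_pos_iff.mpr fun h => hζ (by rw [h, zero_im])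
  have hi : 0 < |ζ.im| := abs_pos.mpr hζ
  have hsl : ∀ t ∈ Set.Icc (0 : ℝ) 1, (1 + (t : ℂ) * ζ) ∈ slitPlane := by
    intro t ht
    rcases ht.1.eq_or_lt with rfl | h
    · simp
    · exact Or.inr (by simpa using ⟨h.ne', hζ⟩)
  have hlow : ∀ t : ℝ, |ζ.im| / ‖ζ‖ ≤ ‖1 + (t : ℂ) * ζ‖ := by
    intro t
    rw [div_le_iff₀ hn]
    refine abs_le_of_sq_le_sq' ?_ (by positivity) |>.2
    rw [mul_pow, Complex.sq_norm, Complex.sq_norm, normSq_apply, normSq_apply, sq_abs]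
    simp only [add_re, one_re, mul_re, ofReal_re, ofReal_im, add_im, one_im, mul_im]
    -- The hint is exact: `|1 + tζ|² |ζ|² - (Im ζ)² = (Re ζ + t |ζ|²)²`.
    nlinarith [sq_nonneg (ζ.re + t * (ζ.re ^ 2 + ζ.im ^ 2))]
  have hd : ∀ t ∈ Set.Icc (0 : ℝ) 1, HasDerivWithinAt (fun t : ℝ => log (1 + (t : ℂ) * ζ))
      (ζ / (1 + (t : ℂ) * ζ)) (Set.Icc 0 1) t := by
    intro t ht
    have h0 : HasDerivAt (fun t : ℝ => 1 + (t : ℂ) * ζ) ζ t := by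
      simpa using ((ofRealCLM.hasDerivAt (x := t)).mul_const ζ).const_add 1
    exact (h0.clog_real (hsl t ht)).hasDerivWithinAt
  have := Convex.norm_image_sub_le_of_norm_hasDerivWithin_le (C := ‖ζ‖ ^ 2 / |ζ.im|) hd
    (fun t _ => by
      rw [norm_div, pow_two, mul_div_assoc, div_eq_mul_inv]
      refine mul_le_mul_of_nonneg_left ?_ hn.le
      rw [← inv_div]
      exact inv_anti₀ (by positivity) (hlow t)) (convex_Icc 0 1)
    (Set.left_mem_Icc.mpr zero_le_one) (Set.right_mem_Icc.mpr zero_le_one)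
  simpa using this

/-- The previous bound is homogeneous of degree one in `1 / r`, so it gives a summable majorant
valid for every index, with no smallness condition. -/
lemma norm_log_one_add_div_le {r : ℝ} (hr : 0 < r) {z : ℂ} (hz : z.im ≠ 0) :
    ‖log (1 + z / (r : ℂ))‖ ≤ ‖z‖ ^ 2 / |z.im| * r⁻¹ := by
  have h : (z / (r : ℂ)).im = z.im / r := div_ofReal_im _ _
  refine (norm_log_one_add_le_of_im_ne_zero (by rw [h]; exact div_ne_zero hz hr.ne')).trans_eq ?_
  rw [h, norm_div, norm_real, Real.norm_of_nonneg hr.le, abs_div, abs_of_pos hr]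
  have : |z.im| ≠ 0 := abs_ne_zero.mpr hz
  field_simp

/-- Off the real axis `logSum a` is holomorphic and its derivative is given termwise. -/
lemma hasDerivAt_logSum (ha : ∀ ν, 0 < a ν) (hs : Summable fun ν => (a ν)⁻¹) {z : ℂ}
    (hz : z.im ≠ 0) :
    ∃ D, HasDerivAt (logSum a) D z ∧ HasSum (fun ν => 1 / ((a ν : ℂ) + z)) D := by
  set h : ℂ → ℝ := fun z => ‖z‖ ^ 2 / |z.im|
  -- A neighbourhood of `z` on which the factor `‖x‖ ^ 2 / |x.im|` stays below a constant, so that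
  -- the majorant is uniform.
  set U : Set ℂ := {x | x.im ≠ 0} ∩ {x | ‖x‖ ^ 2 < (h z + 1) * |x.im|}
  have hU : IsOpen U := (isOpen_ne_fun continuous_im continuous_const).inter
    (isOpen_lt (by fun_prop) (by fun_prop))
  have hzU : z ∈ U := by
    refine ⟨hz, ?_⟩
    have : 0 < |z.im| := abs_pos.mpr hz
    change ‖z‖ ^ 2 < (‖z‖ ^ 2 / |z.im| + 1) * |z.im|
    rw [add_mul, div_mul_cancel₀ _ this.ne']
    linarith
  have hder : ∀ ν, ∀ x ∈ U, HasDerivAt (fun x : ℂ => log (1 + x / (a ν : ℂ)))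
      (1 / ((a ν : ℂ) + x)) x := by
    intro ν x hx
    have h0 : HasDerivAt (fun x : ℂ => 1 + x / (a ν : ℂ)) (1 / (a ν : ℂ)) x :=
      ((hasDerivAt_id x).div_const _).const_add 1
    convert h0.clog (Or.inr (one_add_div_im_ne_zero ha hx.1 ν)) using 1
    have h1 : (a ν : ℂ) ≠ 0 := ofReal_ne_zero.mpr (ha ν).ne'
    have h2 : (a ν : ℂ) + x ≠ 0 := fun h => hx.1 (by simpa using congrArg im h)
    field_simp
  have hdiff : ∀ ν, DifferentiableOn ℂ (fun x : ℂ => log (1 + x / (a ν : ℂ))) U :=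
    fun ν x hx => (hder ν x hx).differentiableAt.differentiableWithinAt
  have hb : ∀ ν, ∀ x ∈ U, ‖log (1 + x / (a ν : ℂ))‖ ≤ (h z + 1) * (a ν)⁻¹ := by
    intro ν x hx
    refine (norm_log_one_add_div_le (ha ν) hx.1).trans ?_
    refine mul_le_mul_of_nonneg_right ?_ (inv_nonneg.mpr (ha ν).le)
    rw [div_le_iff₀ (abs_pos.mpr hx.1)]
    exact hx.2.le
  refine ⟨deriv (logSum a) z, ?_, ?_⟩
  · exact ((differentiableOn_tsum_of_summable_norm (hs.mul_left (h z + 1)) hdiff hU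
      hb).differentiableAt (hU.mem_nhds hzU)).hasDerivAt
  · have := hasSum_deriv_of_summable_norm (hs.mul_left (h z + 1)) hdiff hU hb hzU
    simp only [(hder _ z hzU).deriv] at this
    exact this

lemma im_mul_div_add (r : ℝ) (z : ℂ) :
    (z * (1 / ((r : ℂ) + z))).im = r * z.im / normSq ((r : ℂ) + z) := by
  rw [mul_one_div, div_im]
  simp only [add_re, add_im, ofReal_re, ofReal_im]
  ring

/-- The logarithmic derivative of a canonical product maps either half-plane to itself. -/
lemma hasDerivAt_logSum_im (ha : ∀ ν, 0 < a ν) (hs : Summable fun ν => (a ν)⁻¹) {z : ℂ}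
    (hz : z.im ≠ 0) :
    ∃ D, HasDerivAt (logSum a) D z ∧ 0 ≤ (z * D).im / z.im ∧
      (Nonempty ι → 0 < (z * D).im / z.im) := by
  obtain ⟨D, hD, hsum⟩ := hasDerivAt_logSum ha hs hz
  have h1 : HasSum (fun ν => a ν / normSq ((a ν : ℂ) + z)) ((z * D).im / z.im) := by
    refine ((hasSum_im (hsum.mul_left z)).div_const z.im).congr_fun fun ν => ?_
    rw [im_mul_div_add]
    field_simp
  have h2 : ∀ ν, 0 < a ν / normSq ((a ν : ℂ) + z) := fun ν =>
    div_pos (ha ν) (normSq_pos.mpr fun h => hz (by simpa using congrArg im h))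
  refine ⟨D, hD, h1.nonneg fun ν => (h2 ν).le, fun ⟨ν⟩ => ?_⟩
  exact (h2 ν).trans_le (le_hasSum h1 ν fun j _ => (h2 j).le)

end products

/-! ### The logarithmic coordinate `u` -/

/-- The open strip `0 < Im u < π`, which `exp` maps onto the upper half-plane. -/
def piStrip : Set ℂ := {u | 0 < u.im ∧ u.im < Real.pi}

lemma convex_piStrip : Convex ℝ piStrip :=
  (convex_halfSpace_im_gt 0).inter (convex_halfSpace_im_lt Real.pi)

lemma isOpen_piStrip : IsOpen piStrip :=
  (isOpen_lt continuous_const continuous_im).inter (isOpen_lt continuous_im continuous_const)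

lemma exp_im_pos {u : ℂ} (hu : u ∈ piStrip) : 0 < (exp u).im := by
  rw [exp_im]
  exact mul_pos (Real.exp_pos _) (Real.sin_pos_of_pos_of_lt_pi hu.1 hu.2)

lemma exp_neg_im_neg {u : ℂ} (hu : u ∈ piStrip) : (exp (-u)).im < 0 := by
  rw [exp_im, neg_im, Real.sin_neg]
  have := mul_pos (Real.exp_pos (-u).re) (Real.sin_pos_of_pos_of_lt_pi hu.1 hu.2)
  linarith

lemma mul_exp_mul_im_pos {u : ℂ} (hu : u ∈ piStrip) {κ : ℝ} (hκ : κ = 1 ∨ κ = -1) :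
    0 < κ * (exp (κ * u)).im := by
  rcases hκ with rfl | rfl
  · simpa using exp_im_pos hu
  · simpa using exp_neg_im_neg hu

/-- One statement for all four families: `κ` chooses `w` or `w⁻¹`, and `η = -1` a denominator. With
`ζ = η exp (κ u)` the derivative is `η κ` times `ζ` times the derivative of `logSum a` at `ζ`. That
last product has an imaginary part of the sign of `Im ζ`, which is the sign of `η κ`, so the signs
cancel. -/
lemma hasDerivAt_logSum_exp {ι : Type*} {a : ι → ℝ} (ha : ∀ ν, 0 < a ν)
    (hs : Summable fun ν => (a ν)⁻¹) {u : ℂ} (hu : u ∈ piStrip) {η κ : ℝ}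
    (hη : η = 1 ∨ η = -1) (hκ : κ = 1 ∨ κ = -1) :
    ∃ D, HasDerivAt (fun u => η * logSum a (η * exp (κ * u))) D u ∧ 0 ≤ D.im ∧
      (Nonempty ι → 0 < D.im) := by
  have hpos := mul_exp_mul_im_pos hu hκ
  have hη2 : η * η = 1 := by rcases hη with rfl | rfl <;> norm_num
  have him : ((η : ℂ) * exp (κ * u)).im = η * (exp (κ * u)).im := by simp
  have hne : ((η : ℂ) * exp (κ * u)).im ≠ 0 := by
    rw [him]
    intro h
    rcases mul_eq_zero.mp h with h | h
    · rw [h] at hη2; norm_num at hη2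
    · rw [h] at hpos; simp at hpos
  obtain ⟨D, hD, h0, h1⟩ := hasDerivAt_logSum_im ha hs hne
  have h2 : HasDerivAt (fun u : ℂ => (η : ℂ) * exp (κ * u)) (η * (exp (κ * u) * κ)) u := by
    have : HasDerivAt (fun u : ℂ => (κ : ℂ) * u) κ u := by
      simpa using (hasDerivAt_id u).const_mul (κ : ℂ)
    exact this.cexp.const_mul _
  have h3 := (hD.comp u h2).const_mul (η : ℂ)
  have h4 : ((η : ℂ) * (D * (η * (exp (κ * u) * κ)))).im =
      κ * (exp (κ * u)).im * ((η * exp (κ * u) * D).im / ((η : ℂ) * exp (κ * u)).im) := by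
    have h5 : (η : ℂ) * (D * (η * (exp (κ * u) * κ))) =
        ((η * κ : ℝ) : ℂ) * (η * exp (κ * u) * D) := by push_cast; ring
    rw [h5, im_ofReal_mul]
    have h6 : η * ((η : ℂ) * exp (κ * u)).im = (exp (κ * u)).im := by
      rw [him, ← mul_assoc, hη2, one_mul]
    rw [← h6]
    field_simp
  refine ⟨_, h3, ?_, fun hne => ?_⟩
  · rw [h4]; exact mul_nonneg hpos.le h0
  · rw [h4]; exact mul_pos hpos (h1 hne)

/-! ### The generating function and its logarithm on the strip -/

section genFun

variable {ι₁ ι₂ ι₃ ι₄ : Type*}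

/-- The logarithm of `u ↦ genFun A A₀ a b c d (exp u)` on `piStrip`. -/
noncomputable def logGen (A A₀ : ℝ) (a : ι₁ → ℝ) (b : ι₂ → ℝ) (c : ι₃ → ℝ) (d : ι₄ → ℝ)
    (u : ℂ) : ℂ :=
  A * exp u + A₀ * exp (-u) + (logSum a (exp u) - logSum b (-exp u)) +
    (logSum c (exp (-u)) - logSum d (-exp (-u)))

lemma genFun_eq (A A₀ : ℝ) (a : ι₁ → ℝ) (b : ι₂ → ℝ) (c : ι₃ → ℝ) (d : ι₄ → ℝ) (w : ℂ) :
    genFun A A₀ a b c d w = exp (A * w + A₀ * w⁻¹) * (facProd a w / facProd b (-w)) *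
      (facProd c w⁻¹ / facProd d (-w⁻¹)) := by
  simp only [genFun, facProd, neg_div, sub_eq_add_neg]

lemma genFun_conj (A A₀ : ℝ) (a : ι₁ → ℝ) (b : ι₂ → ℝ) (c : ι₃ → ℝ) (d : ι₄ → ℝ) (w : ℂ) :
    genFun A A₀ a b c d (starRingEnd ℂ w) = starRingEnd ℂ (genFun A A₀ a b c d w) := by
  simp only [genFun_eq, map_mul, map_div₀, ← facProd_conj, ← exp_conj, map_add, conj_ofReal,
    map_inv₀, map_neg]

lemma powComp_conj (p : ℤ) (k : ℕ) (A A₀ : ℝ) (a : ι₁ → ℝ) (b : ι₂ → ℝ) (c : ι₃ → ℝ) (d : ι₄ → ℝ)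
    (z : ℂ) : powComp p k A A₀ a b c d (starRingEnd ℂ z) =
      starRingEnd ℂ (powComp p k A A₀ a b c d z) := by
  simp only [powComp, map_mul, map_zpow₀, ← genFun_conj, map_pow]

/-- `G ^ k` is a function of `z ^ k` that commutes with conjugation. This keeps `α`-points off the
rays where `z ^ k` is real. -/
lemma powComp_pow_im_eq_zero (p : ℤ) (k : ℕ) (A A₀ : ℝ) (a : ι₁ → ℝ) (b : ι₂ → ℝ) (c : ι₃ → ℝ)
    (d : ι₄ → ℝ) {z : ℂ} (hz : (z ^ k).im = 0) : (powComp p k A A₀ a b c d z ^ k).im = 0 := by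
  rw [← conj_eq_iff_im] at hz ⊢
  have h : powComp p k A A₀ a b c d z ^ k = (z ^ k) ^ p * genFun A A₀ a b c d (z ^ k) ^ k := by
    rw [powComp, mul_pow]
    congr 1
    rw [← zpow_natCast, ← zpow_natCast, zpow_comm]
  rw [h, map_mul, map_zpow₀, map_pow (starRingEnd ℂ) (genFun _ _ _ _ _ _ _), ← genFun_conj, hz]

section

variable {A A₀ : ℝ} {a : ι₁ → ℝ} {b : ι₂ → ℝ} {c : ι₃ → ℝ} {d : ι₄ → ℝ}

lemma exp_logGen
    (ha : ∀ ν, 0 < a ν) (hb : ∀ μ, 0 < b μ) (hc : ∀ ν, 0 < c ν) (hd : ∀ μ, 0 < d μ)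
    (hsa : Summable fun ν => (a ν)⁻¹) (hsb : Summable fun μ => (b μ)⁻¹)
    (hsc : Summable fun ν => (c ν)⁻¹) (hsd : Summable fun μ => (d μ)⁻¹) {u : ℂ} (hu : u ∈ piStrip) :
    exp (logGen A A₀ a b c d u) = genFun A A₀ a b c d (exp u) := by
  have h1 := exp_im_pos hu
  have h2 := exp_neg_im_neg hu
  rw [genFun_eq, logGen, ← exp_neg, exp_add, exp_add, exp_sub, exp_sub,
    exp_logSum ha hsa h1.ne', exp_logSum hb hsb (by rw [neg_im]; linarith),
    exp_logSum hc hsc h2.ne, exp_logSum hd hsd (by rw [neg_im]; linarith)]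

lemma hasDerivAt_logGen (hA : 0 ≤ A) (hA₀ : 0 ≤ A₀)
    (ha : ∀ ν, 0 < a ν) (hb : ∀ μ, 0 < b μ) (hc : ∀ ν, 0 < c ν) (hd : ∀ μ, 0 < d μ)
    (hsa : Summable fun ν => (a ν)⁻¹) (hsb : Summable fun μ => (b μ)⁻¹)
    (hsc : Summable fun ν => (c ν)⁻¹) (hsd : Summable fun μ => (d μ)⁻¹)
    (hne : 0 < A ∨ 0 < A₀ ∨ Nonempty ι₁ ∨ Nonempty ι₂ ∨ Nonempty ι₃ ∨ Nonempty ι₄)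
    {u : ℂ} (hu : u ∈ piStrip) :
    ∃ D, HasDerivAt (logGen A A₀ a b c d) D u ∧ 0 < D.im := by
  have h1 := exp_im_pos hu
  have h2 := exp_neg_im_neg hu
  obtain ⟨Da, hDa, ha0, ha1⟩ := hasDerivAt_logSum_exp ha hsa hu (η := 1) (κ := 1) (by simp) (by simp)
  obtain ⟨Db, hDb, hb0, hb1⟩ := hasDerivAt_logSum_exp hb hsb hu (η := -1) (κ := 1) (by simp) (by simp)
  obtain ⟨Dc, hDc, hc0, hc1⟩ := hasDerivAt_logSum_exp hc hsc hu (η := 1) (κ := -1) (by simp) (by simp)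
  obtain ⟨Dd, hDd, hd0, hd1⟩ := hasDerivAt_logSum_exp hd hsd hu (η := -1) (κ := -1) (by simp) (by simp)
  have hE : HasDerivAt (fun u : ℂ => (A : ℂ) * exp u) (A * exp u) u := (hasDerivAt_exp u).const_mul _
  have hE' : HasDerivAt (fun u : ℂ => (A₀ : ℂ) * exp (-u)) (A₀ * (exp (-u) * -1)) u :=
    (hasDerivAt_neg u).cexp.const_mul _
  refine ⟨_, (((hE.add hE').add (hDa.add hDb)).add (hDc.add hDd)).congr_of_eventuallyEq
    (Eventually.of_forall fun v => ?_), ?_⟩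
  · simp only [logGen, Pi.add_apply]
    push_cast
    simp only [one_mul, neg_mul, ← sub_eq_add_neg]
  · have e1 : ((A : ℂ) * exp u).im = A * (exp u).im := im_ofReal_mul _ _
    have e2 : ((A₀ : ℂ) * (exp (-u) * -1)).im = A₀ * -(exp (-u)).im := by
      rw [im_ofReal_mul]; simp
    have f1 : 0 ≤ A * (exp u).im := mul_nonneg hA h1.le
    have f2 : 0 ≤ A₀ * -(exp (-u)).im := mul_nonneg hA₀ (by linarith)
    simp only [add_im, e1, e2]
    rcases hne with h | h | h | h | h | h
    · have := mul_pos h h1; linarith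
    · have := mul_pos h (neg_pos.mpr h2); linarith
    · have := ha1 h; linarith
    · have := hb1 h; linarith
    · have := hc1 h; linarith
    · have := hd1 h; linarith

lemma genFun_nontrivial (hA : 0 ≤ A) (hA₀ : 0 ≤ A₀) {p : ℤ} {k : ℕ}
    (hG : ∃ z : ℂ, z ≠ 0 ∧ powComp p k A A₀ a b c d z ≠ z ^ p) :
    0 < A ∨ 0 < A₀ ∨ Nonempty ι₁ ∨ Nonempty ι₂ ∨ Nonempty ι₃ ∨ Nonempty ι₄ := by
  by_contra! h
  obtain ⟨h1, h2, h3, h4, h5, h6⟩ := h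
  obtain ⟨z, -, hz⟩ := hG
  apply hz
  simp [powComp, genFun, le_antisymm h1 hA, le_antisymm h2 hA₀]

/-- The function `powComp` is analytic at every point where its Lean value is not zero. -/
lemma analyticAt_powComp {p : ℤ} {k : ℕ} (hp : p ≠ 0)
    (hsa : Summable fun ν => (a ν)⁻¹) (hsb : Summable fun μ => (b μ)⁻¹)
    (hsc : Summable fun ν => (c ν)⁻¹) (hsd : Summable fun μ => (d μ)⁻¹) {z : ℂ}
    (hz : powComp p k A A₀ a b c d z ≠ 0) : AnalyticAt ℂ (powComp p k A A₀ a b c d) z := by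
  have hz0 : z ≠ 0 := by
    rintro rfl
    exact hz (by rw [powComp, zero_zpow _ hp, zero_mul])
  -- Division by zero gives `0`, so a vanishing denominator would make the value zero.
  have hb0 : facProd b (-z ^ k) ≠ 0 := fun h => hz (by simp [powComp, genFun_eq, h])
  have hd0 : facProd d (-(z ^ k)⁻¹) ≠ 0 := fun h => hz (by simp only [powComp, genFun_eq, h]; simp)
  have hk0 : z ^ k ≠ 0 := pow_ne_zero _ hz0
  have hid : AnalyticAt ℂ (fun z : ℂ => z) z := analyticAt_id
  have hpow : AnalyticAt ℂ (fun z : ℂ => z ^ k) z := hid.pow k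
  have hinv : AnalyticAt ℂ (fun z : ℂ => (z ^ k)⁻¹) z := hpow.inv hk0
  have e : powComp p k A A₀ a b c d = fun z => z ^ p * (exp (A * z ^ k + A₀ * (z ^ k)⁻¹) *
      (facProd a (z ^ k) / facProd b (-z ^ k)) *
      (facProd c (z ^ k)⁻¹ / facProd d (-(z ^ k)⁻¹))) := by
    funext z
    rw [powComp, genFun_eq]
  rw [e]
  refine (hid.zpow hz0).mul ((AnalyticAt.mul ?_ ?_).mul ?_)
  · exact ((analyticAt_const.mul hpow).add (analyticAt_const.mul hinv)).cexp
  · exact (((differentiable_facProd hsa).analyticAt _).fun_comp hpow).div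
      (((differentiable_facProd hsb).analyticAt _).fun_comp hpow.neg) hb0
  · exact (((differentiable_facProd hsc).analyticAt _).fun_comp hinv).div
      (((differentiable_facProd hsd).analyticAt _).fun_comp hinv.neg) hd0

end

end genFun

/-! ### Functions on the strip whose derivative has positive imaginary part -/

section univalent

variable {L : ℂ → ℂ}

/-- A function whose derivative has positive imaginary part has difference quotients with positive
imaginary part (Noshiro–Warschawski). -/
lemma im_slope_pos (hL : ∀ u ∈ piStrip, ∃ D, HasDerivAt L D u ∧ 0 < D.im) {u v : ℂ}
    (hu : u ∈ piStrip) (hv : v ∈ piStrip) (huv : u ≠ v) : 0 < ((L v - L u) / (v - u)).im := by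
  have hsub : v - u ≠ 0 := sub_ne_zero.mpr huv.symm
  set γ : ℝ → ℂ := fun t => u + (t : ℂ) * (v - u)
  have hγ : ∀ t, HasDerivAt γ (v - u) t := fun t => by
    have := ((ofRealCLM.hasDerivAt (x := t)).mul_const (v - u)).const_add u
    rwa [ofRealCLM_apply, ofReal_one, one_mul] at this
  have hmem : ∀ t ∈ Set.Icc (0 : ℝ) 1, γ t ∈ piStrip := fun t ht => by
    simpa [γ] using convex_piStrip.add_smul_sub_mem hu hv ht
  choose! D hD hpos using hL
  -- Dividing by `v - u` before taking imaginary parts makes the derivative along the segment equal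
  -- to `Im L'`, so the real mean value theorem applies.
  have hcomp : ∀ t ∈ Set.Icc (0 : ℝ) 1,
      HasDerivAt (fun t => (L (γ t) / (v - u)).im) (D (γ t)).im t := fun t ht => by
    have h1 := ((hD _ (hmem t ht)).comp_of_eq t (hγ t) rfl).div_const (v - u)
    rw [mul_div_cancel_right₀ _ hsub] at h1
    exact imCLM.hasFDerivAt.comp_hasDerivAt t h1
  obtain ⟨t, ht, h⟩ := exists_hasDerivAt_eq_slope (fun t => (L (γ t) / (v - u)).im)
    (fun t => (D (γ t)).im) zero_lt_one
    (fun t ht => (hcomp t ht).continuousAt.continuousWithinAt)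
    (fun t ht => hcomp t (Set.Ioo_subset_Icc_self ht))
  have h2 := hpos _ (hmem t (Set.Ioo_subset_Icc_self ht))
  rw [h] at h2
  simpa [γ, sub_div] using h2

/-- The increments of such a function in terms of a difference quotient `r + i q` with `q > 0`. -/
lemma exists_slope (hL : ∀ u ∈ piStrip, ∃ D, HasDerivAt L D u ∧ 0 < D.im) {u v : ℂ}
    (hu : u ∈ piStrip) (hv : v ∈ piStrip) (huv : u ≠ v) : ∃ r q : ℝ, 0 < q ∧
      (L v).re - (L u).re = r * (v.re - u.re) - q * (v.im - u.im) ∧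
      (L v).im - (L u).im = r * (v.im - u.im) + q * (v.re - u.re) := by
  have hsub : v - u ≠ 0 := sub_ne_zero.mpr huv.symm
  refine ⟨((L v - L u) / (v - u)).re, _, im_slope_pos hL hu hv huv, ?_⟩
  have h : L v - L u = (L v - L u) / (v - u) * (v - u) := (div_mul_cancel₀ _ hsub).symm
  have h1 := congrArg re h
  have h2 := congrArg im h
  simp only [mul_re, mul_im, sub_re, sub_im] at h1 h2
  exact ⟨h1, h2⟩

/-- On a level curve of `Re L` the imaginary part of `L` increases with the real part. -/
lemma im_lt_im_iff_re_lt_re (hL : ∀ u ∈ piStrip, ∃ D, HasDerivAt L D u ∧ 0 < D.im) {u v : ℂ}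
    (hu : u ∈ piStrip) (hv : v ∈ piStrip) (h : (L u).re = (L v).re) :
    (L u).im < (L v).im ↔ u.re < v.re := by
  rcases eq_or_ne u v with rfl | huv
  · simp
  obtain ⟨r, q, hq, h1, h2⟩ := exists_slope hL hu hv huv
  -- On the level set `r Δx = q Δy`; this eliminates `Δy` from the increment of `Im L`.
  have h3 : q * ((L v).im - (L u).im) = (r ^ 2 + q ^ 2) * (v.re - u.re) := by
    rw [h2]; linear_combination r * (h1 + h)
  have h4 : 0 < r ^ 2 + q ^ 2 := by positivity
  constructor <;> intro h5
  · have := mul_pos hq (sub_pos.mpr h5)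
    rw [h3] at this
    exact sub_pos.mp (pos_of_mul_pos_right this h4.le)
  · have := mul_pos h4 (sub_pos.mpr h5)
    rw [← h3] at this
    exact sub_pos.mp (pos_of_mul_pos_right this hq.le)

lemma re_lt_re_of_im_lt_im (hL : ∀ u ∈ piStrip, ∃ D, HasDerivAt L D u ∧ 0 < D.im) {u v : ℂ}
    (hu : u ∈ piStrip) (hv : v ∈ piStrip) (h : u.re = v.re) (h' : u.im < v.im) :
    (L v).re < (L u).re := by
  obtain ⟨r, q, hq, h1, -⟩ := exists_slope hL hu hv (fun e => by rw [e] at h'; exact lt_irrefl _ h')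
  rw [h, sub_self, mul_zero, zero_sub] at h1
  have := mul_pos hq (sub_pos.mpr h')
  linarith

lemma eq_of_re_eq (hL : ∀ u ∈ piStrip, ∃ D, HasDerivAt L D u ∧ 0 < D.im) {u v : ℂ}
    (hu : u ∈ piStrip) (hv : v ∈ piStrip) (h : u.re = v.re) (h' : (L u).re = (L v).re) : u = v := by
  rcases lt_trichotomy u.im v.im with hlt | heq | hlt
  · exact absurd h' (re_lt_re_of_im_lt_im hL hu hv h hlt).ne'
  · exact Complex.ext h heq
  · exact absurd h' (re_lt_re_of_im_lt_im hL hv hu h.symm hlt).ne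

end univalent

/-! ### Level curves of `Re L` and intermediate values of `Im L` -/

/-- The level set of a function decreasing in its second variable, clamped to a strip, is the graph
of a continuous function. -/
lemma exists_continuous_level {f : ℝ → ℝ → ℝ} {α β B : ℝ} (hαβ : α ≤ β)
    (hx : ∀ θ ∈ Set.Icc α β, Continuous fun x => f x θ)
    (hθ : ∀ x, ContinuousOn (f x) (Set.Icc α β))
    (hanti : ∀ x, StrictAntiOn (f x) (Set.Icc α β)) :
    ∃ Θ : ℝ → ℝ, Continuous Θ ∧ (∀ x, Θ x ∈ Set.Icc α β) ∧ (∀ x, α < Θ x → B ≤ f x (Θ x)) ∧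
      (∀ x, Θ x < β → f x (Θ x) ≤ B) := by
  have key : ∀ x, ∃ θ ∈ Set.Icc α β, (α < θ → B ≤ f x θ) ∧ (θ < β → f x θ ≤ B) := by
    intro x
    by_cases h1 : f x α ≤ B
    · exact ⟨α, Set.left_mem_Icc.mpr hαβ, fun h => absurd h (lt_irrefl _), fun _ => h1⟩
    by_cases h2 : B ≤ f x β
    · exact ⟨β, Set.right_mem_Icc.mpr hαβ, fun _ => h2, fun h => absurd h (lt_irrefl _)⟩
    obtain ⟨θ, hθ', h⟩ := intermediate_value_Icc' hαβ (hθ x) ⟨(not_le.mp h2).le, (not_le.mp h1).le⟩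
    exact ⟨θ, hθ', fun _ => h.ge, fun _ => h.le⟩
  choose Θ hmem hlow hup using key
  refine ⟨Θ, ?_, hmem, hlow, hup⟩
  rw [continuous_iff_continuousAt]
  intro x
  refine tendsto_order.mpr ⟨fun θ₀ h0 => ?_, fun θ₀ h0 => ?_⟩
  · rcases lt_or_ge θ₀ α with h | h
    · exact Eventually.of_forall fun y => h.trans_le (hmem y).1
    obtain ⟨θ₁, h1, h2⟩ := exists_between h0
    have m1 : θ₁ ∈ Set.Icc α β := ⟨h.trans h1.le, h2.le.trans (hmem x).2⟩
    have h3 : B < f x θ₁ := (hlow x (h.trans_lt h0)).trans_lt (hanti x m1 (hmem x) h2)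
    filter_upwards [(hx θ₁ m1).continuousAt.eventually_const_lt h3] with y hy
    refine h1.trans_le (not_lt.mp fun h4 => ?_)
    have := (hanti y (hmem y) m1 h4).trans_le (hup y (h4.trans_le m1.2))
    exact lt_asymm hy this
  · rcases lt_or_ge β θ₀ with h | h
    · exact Eventually.of_forall fun y => (hmem y).2.trans_lt h
    obtain ⟨θ₁, h1, h2⟩ := exists_between h0
    have m1 : θ₁ ∈ Set.Icc α β := ⟨(hmem x).1.trans h1.le, h2.le.trans h⟩
    have h3 : f x θ₁ < B := (hanti x (hmem x) m1 h1).trans_le (hup x (h0.trans_le h))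
    filter_upwards [(hx θ₁ m1).continuousAt.eventually_lt_const h3] with y hy
    refine (not_lt.mp fun h4 => ?_ : Θ y ≤ θ₁).trans_lt h2
    have := (hlow y (m1.1.trans_lt h4)).trans_lt (hanti y m1 (hmem y) h4)
    exact lt_asymm hy this

/-- Near a horizontal segment on which `n` and `d` are real and `n ≠ 0`, the bounded quotient
`n / d` has no value of a given nonreal argument. -/
lemma exists_boundary_gap {n d : ℂ → ℂ} (hn : Continuous n) (hd : Continuous d) {j : ℝ}
    (hnr : ∀ u : ℂ, u.im = j → (n u).im = 0) (hdr : ∀ u : ℂ, u.im = j → (d u).im = 0)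
    (hn0 : ∀ u : ℂ, u.im = j → n u ≠ 0) {s C : ℝ} (hs : Real.sin s ≠ 0) (x₁ x₂ : ℝ) :
    ∃ δ > 0, ∀ u : ℂ, x₁ ≤ u.re → u.re ≤ x₂ → |u.im - j| < δ → ∀ t : ℝ, 0 ≤ t → t ≤ C →
      n u ≠ t * exp (s * I) * d u := by
  set K : Set ℂ := (fun x : ℝ => (x : ℂ) + j * I) '' Set.Icc x₁ x₂
  -- Both conditions fail at a solution of `n u = t e^{is} d u` with `0 ≤ t ≤ C`. The first holds on
  -- the line where `d ≠ 0`, the second at the zeros of `d`. Compactness of the segment then gives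
  -- `δ`.
  set U : Set ℂ := {u | (exp (-(s * I)) * n u * starRingEnd ℂ (d u)).im ≠ 0} ∪
    {u | C * ‖d u‖ < ‖n u‖}
  have hK : IsCompact K := isCompact_Icc.image (by fun_prop)
  have hU : IsOpen U := by
    refine (isOpen_ne_fun ?_ continuous_const).union (isOpen_lt (by fun_prop) (by fun_prop))
    exact continuous_im.comp ((continuous_const.mul hn).mul (continuous_conj.comp hd))
  have hKU : K ⊆ U := by
    rintro _ ⟨x, -, rfl⟩
    have him : ((x : ℂ) + j * I).im = j := by simp
    beta_reduce
    generalize (x : ℂ) + j * I = u at him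
    by_cases h0 : d u = 0
    · right
      change C * ‖d u‖ < ‖n u‖
      rw [h0, norm_zero, mul_zero]
      exact norm_pos_iff.mpr (hn0 u him)
    · left
      have e1 : n u = ((n u).re : ℂ) := Complex.ext rfl (by simpa using hnr u him)
      have e2 : d u = ((d u).re : ℂ) := Complex.ext rfl (by simpa using hdr u him)
      have e3 : (exp (-(s * I)) * n u * starRingEnd ℂ (d u)).im =
          -Real.sin s * ((n u).re * (d u).re) := by
        rw [e1, e2, conj_ofReal, mul_assoc, ← ofReal_mul, mul_comm, im_ofReal_mul, ← neg_mul,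
          ← ofReal_neg, exp_ofReal_mul_I_im, Real.sin_neg]
        simp only [ofReal_re]
        ring
      change _ ≠ 0
      rw [e3]
      refine mul_ne_zero (neg_ne_zero.mpr hs) (mul_ne_zero ?_ ?_)
      · intro h; exact hn0 u him (by rw [e1, h, ofReal_zero])
      · intro h; exact h0 (by rw [e2, h, ofReal_zero])
  obtain ⟨δ, hδ, hsub⟩ := hK.exists_thickening_subset_open hU hKU
  refine ⟨δ, hδ, fun u h1 h2 h3 t ht htC heq => ?_⟩
  have hmem : u ∈ U := hsub <| Metric.mem_thickening_iff.mpr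
    ⟨(u.re : ℂ) + j * I, ⟨u.re, ⟨h1, h2⟩, rfl⟩, by
      rw [dist_eq]
      have : u - ((u.re : ℂ) + j * I) = ((u.im - j : ℝ) : ℂ) * I := by
        apply Complex.ext <;> simp
      rw [this, norm_mul, norm_I, mul_one, norm_real]
      exact h3⟩
  rcases hmem with h | h
  · apply h
    have : exp (-(s * I)) * n u * starRingEnd ℂ (d u) = ((t * normSq (d u) : ℝ) : ℂ) := by
      rw [heq]
      push_cast
      rw [← mul_conj, show exp (-(s * I)) * (t * exp (s * I) * d u) * starRingEnd ℂ (d u) =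
        (exp (-(s * I)) * exp (s * I)) * (t * (d u * starRingEnd ℂ (d u))) by ring, ← exp_add]
      simp
    rw [this, ofReal_im]
  · have h' : C * ‖d u‖ < ‖n u‖ := h
    rw [heq, norm_mul, norm_mul, norm_exp_ofReal_mul_I, mul_one, norm_real,
      Real.norm_of_nonneg ht] at h'
    exact absurd h' (not_lt.mpr (mul_le_mul_of_nonneg_right htC (norm_nonneg _)))

/-- If a vertical line meets the image of the strip at two points, then every point between them
that is not on one of the lines `Im = π N` lies in the image. -/
lemma exists_mem_level {L n d : ℂ → ℂ}
    (hL : ∀ u ∈ piStrip, ∃ D, HasDerivAt L D u ∧ 0 < D.im)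
    (hn : Continuous n) (hd : Continuous d)
    (hLnd : ∀ u ∈ piStrip, exp (L u) * d u = n u)
    (hnr : ∀ u : ℂ, (u.im = 0 ∨ u.im = Real.pi) → (n u).im = 0)
    (hdr : ∀ u : ℂ, (u.im = 0 ∨ u.im = Real.pi) → (d u).im = 0)
    (hn0 : ∀ u : ℂ, u.im = 0 → n u ≠ 0) (hd0 : ∀ u : ℂ, u.im = Real.pi → d u ≠ 0)
    {u v : ℂ} (hu : u ∈ piStrip) (hv : v ∈ piStrip) (huv : (L u).re = (L v).re) {s : ℝ}
    (h1 : (L u).im < s) (h2 : s < (L v).im) (hs : Real.sin s ≠ 0) :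
    ∃ x ∈ piStrip, (L x).re = (L u).re ∧ (L x).im = s := by
  set B := (L u).re
  have hx : u.re < v.re := (im_lt_im_iff_re_lt_re hL hu hv huv).mp (h1.trans h2)
  obtain ⟨δ₁, hδ₁, hgap₁⟩ := exists_boundary_gap hn hd (j := 0) (fun u h => hnr u (.inl h))
    (fun u h => hdr u (.inl h)) hn0 (C := Real.exp B) hs u.re v.re
  obtain ⟨δ₂, hδ₂, hgap₂⟩ := exists_boundary_gap hd hn (j := Real.pi) (fun u h => hdr u (.inr h))
    (fun u h => hnr u (.inr h)) hd0 (C := Real.exp (-B)) (s := -s)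
    (by rw [Real.sin_neg]; exact neg_ne_zero.mpr hs) u.re v.re
  -- Small enough that `u` and `v` lie strictly inside the clamped strip and that both of its edges
  -- fall into the gaps.
  obtain ⟨ε, hε, hε'⟩ : ∃ ε > 0, ε < δ₁ ∧ ε < δ₂ ∧ ε < u.im ∧ ε < v.im ∧ ε < Real.pi - u.im ∧
      ε < Real.pi - v.im ∧ ε < Real.pi / 2 := by
    have : ∀ᶠ ε in 𝓝[>] (0 : ℝ), ε < δ₁ ∧ ε < δ₂ ∧ ε < u.im ∧ ε < v.im ∧ ε < Real.pi - u.im ∧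
      ε < Real.pi - v.im ∧ ε < Real.pi / 2 := by
      have key : ∀ r : ℝ, 0 < r → ∀ᶠ ε in 𝓝[>] (0 : ℝ), ε < r := fun r hr =>
        (eventually_lt_nhds hr).filter_mono nhdsWithin_le_nhds
      filter_upwards [key _ hδ₁, key _ hδ₂, key _ hu.1, key _ hv.1, key _ (sub_pos.mpr hu.2),
        key _ (sub_pos.mpr hv.2), key _ Real.pi_div_two_pos] with ε a b c d e f g
      exact ⟨a, b, c, d, e, f, g⟩
    obtain ⟨ε, h, h'⟩ := (this.and self_mem_nhdsWithin).exists
    exact ⟨ε, h', h⟩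
  obtain ⟨e1, e2, e3, e4, e5, e6, e7⟩ := hε'
  have hpt : ∀ x : ℝ, ∀ θ ∈ Set.Icc ε (Real.pi - ε), (x : ℂ) + θ * I ∈ piStrip := fun x θ hθ => by
    simp only [piStrip, Set.mem_ofPred_eq, add_im, ofReal_im, mul_im, ofReal_re, I_im, I_re]
    constructor <;> linarith [hθ.1, hθ.2]
  have hLc : ∀ u ∈ piStrip, ContinuousAt L u := fun u hu => by
    obtain ⟨D, hD, -⟩ := hL u hu
    exact hD.continuousAt
  obtain ⟨Θ, hΘ, hΘm, hlow, hup⟩ := exists_continuous_level (B := B)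
    (f := fun x θ => (L ((x : ℂ) + θ * I)).re) (show ε ≤ Real.pi - ε by linarith)
    (fun θ hθ => continuous_re.comp <| continuous_iff_continuousAt.mpr fun x =>
      ContinuousAt.comp' (hLc _ (hpt x θ hθ)) (by fun_prop))
    (fun x θ hθ => (continuous_re.continuousAt.comp <|
      ContinuousAt.comp' (f := fun θ : ℝ => (x : ℂ) + θ * I) (hLc _ (hpt x θ hθ))
        (by fun_prop)).continuousWithinAt)
    (fun x θ hθ θ' hθ' hlt => re_lt_re_of_im_lt_im hL (hpt x θ hθ) (hpt x θ' hθ')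
      (by simp) (by simpa using hlt))
  have hcurve : Continuous fun x : ℝ => (L ((x : ℂ) + Θ x * I)).im :=
    continuous_im.comp <| continuous_iff_continuousAt.mpr fun x =>
      ContinuousAt.comp' (hLc _ (hpt x _ (hΘm x))) (by fun_prop)
  have hend : ∀ w ∈ piStrip, (L w).re = B → ε < w.im → ε < Real.pi - w.im →
      (w.re : ℂ) + Θ w.re * I = w := by
    intro w hw hB hw1 hw2
    have hp := hpt w.re _ (hΘm w.re)
    have him : ((w.re : ℂ) + Θ w.re * I).im = Θ w.re := by simp
    have hre : ((w.re : ℂ) + Θ w.re * I).re = w.re := by simp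
    rcases lt_trichotomy (Θ w.re) w.im with h | h | h
    · have h3 := re_lt_re_of_im_lt_im hL hp hw hre (by rwa [him])
      have h4 := hup w.re (by linarith)
      linarith
    · exact Complex.ext hre (by rw [him, h])
    · have h3 := re_lt_re_of_im_lt_im hL hw hp hre.symm (by rwa [him])
      have h4 := hlow w.re (by linarith)
      linarith
  have hIVT := intermediate_value_Icc hx.le hcurve.continuousOn
  rw [hend u hu rfl e3 e5, hend v hv huv.symm e4 e6] at hIVT
  obtain ⟨x, hxI, hxs⟩ := hIVT ⟨h1.le, h2.le⟩
  have hp := hpt x _ (hΘm x)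
  set y : ℂ := (x : ℂ) + Θ x * I
  have hyre : y.re = x := by simp [y]
  have hyim : y.im = Θ x := by simp [y]
  have hexp : exp (L y) = (Real.exp (L y).re : ℂ) * exp (s * I) := by
    rw [← hxs, ofReal_exp, ← exp_add, re_add_im]
  refine ⟨y, hp, le_antisymm ?_ ?_, hxs⟩
  -- If the curve were clamped at the upper edge, then `Re L ≥ B` there. So `d / n` would be bounded
  -- by `e^{-B}` with argument `-s`, against the second gap. The lower edge is symmetric, with `n /
  -- d`.
  · refine hup x ((hΘm x).2.lt_of_ne fun h => ?_)
    have hB : B ≤ (L y).re := hlow x (by rw [h]; linarith)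
    refine hgap₂ y (hyre ▸ hxI.1) (hyre ▸ hxI.2)
      (by rw [hyim, h, abs_lt]; constructor <;> linarith)
      (Real.exp (-(L y).re)) (Real.exp_pos _).le (Real.exp_le_exp.mpr (by linarith)) ?_
    rw [← hLnd y hp, hexp, show ((Real.exp (-(L y).re) : ℝ) : ℂ) * exp ((-s : ℝ) * I) *
      (Real.exp (L y).re * exp (s * I) * d y) = ((Real.exp (-(L y).re) : ℝ) * Real.exp (L y).re) *
        (exp ((-s : ℝ) * I) * exp (s * I)) * d y by ring, ← exp_add, ← ofReal_mul, ← Real.exp_add]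
    simp
  · refine hlow x ((hΘm x).1.lt_of_ne fun h => ?_)
    have hB : (L y).re ≤ B := hup x (by rw [← h]; linarith)
    refine hgap₁ y (hyre ▸ hxI.1) (hyre ▸ hxI.2)
      (by rw [hyim, ← h, abs_lt]; constructor <;> linarith)
      (Real.exp (L y).re) (Real.exp_pos _).le (Real.exp_le_exp.mpr hB) ?_
    rw [← hLnd y hp, hexp]

/-! ### Sectors as images of the strip -/

section sectors

variable {k : ℕ}

/-- Trades the principal argument for a free logarithm, so that sector indices can be computed with
as integers. -/
lemma mem_sector_iff (hk : 0 < k) {s : ℤ} {z : ℂ} :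
    z ∈ sector k s ↔ ∃ u ∈ piStrip, z = exp ((u + Real.pi * s * I) / k) := by
  have hk' : (k : ℂ) ≠ 0 := Nat.cast_ne_zero.mpr hk.ne'
  have hkr : (0 : ℝ) < k := Nat.cast_pos.mpr hk
  have hroot : rootE k (-s) = exp (-(Real.pi * s * I / k)) := by
    rw [rootE]
    congr 1
    push_cast
    field_simp
  constructor
  · rintro ⟨hz, h1, h2⟩
    rw [hroot] at h1 h2
    set v := z * exp (-(Real.pi * s * I / k))
    have hv : v ≠ 0 := mul_ne_zero hz (exp_ne_zero _)
    have him : ((k : ℂ) * log v).im = k * arg v := by simp [log_im]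
    refine ⟨k * log v, ⟨?_, ?_⟩, ?_⟩
    · rw [him]; exact mul_pos hkr h1
    · rw [him, mul_comm]; exact (lt_div_iff₀ hkr).mp h2
    · rw [add_div, mul_div_cancel_left₀ _ hk', exp_add, exp_log hv, mul_assoc, ← exp_add]
      simp
  · rintro ⟨u, hu, rfl⟩
    have hpi : u.im / k ≤ u.im := div_le_self hu.1.le (by exact_mod_cast hk)
    have him : (u / (k : ℂ)).im = u.im / k := by rw [← ofReal_natCast, div_ofReal_im]
    have h : exp ((u + Real.pi * s * I) / k) * rootE k (-s) = exp (u / k) := by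
      rw [hroot, ← exp_add]
      congr 1
      ring
    have harg : arg (exp (u / k)) = u.im / k := by
      have h0 : 0 < u.im / k := div_pos hu.1 hkr
      rw [← log_im, log_exp, him] <;> rw [him] <;> linarith [hu.2, Real.pi_pos]
    refine ⟨exp_ne_zero _, ?_⟩
    rw [h, harg]
    exact ⟨div_pos hu.1 hkr, div_lt_div_of_pos_right hu.2 hkr⟩

lemma exp_div_eq_exp_div_iff (hk : 0 < k) {x y : ℂ} :
    exp (x / k) = exp (y / k) ↔ ∃ j : ℤ, x = y + 2 * Real.pi * k * j * I := by
  have hk' : (k : ℂ) ≠ 0 := Nat.cast_ne_zero.mpr hk.ne'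
  rw [exp_eq_exp_iff_exists_int]
  refine exists_congr fun j => ?_
  rw [div_eq_iff hk', add_mul, div_mul_cancel₀ _ hk']
  constructor <;> rintro h <;> rw [h] <;> ring

lemma sector_subset_of_dvd (hk : 0 < k) {s t : ℤ} (h : (2 * k : ℤ) ∣ s - t) :
    sector k s ⊆ sector k t := by
  intro z hz
  obtain ⟨u, hu, rfl⟩ := (mem_sector_iff hk).mp hz
  obtain ⟨j, hj⟩ := h
  refine (mem_sector_iff hk).mpr ⟨u, hu, (exp_div_eq_exp_div_iff hk).mpr ⟨j, ?_⟩⟩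
  have : (s : ℂ) = t + 2 * k * j := by
    rw [eq_add_of_sub_eq' hj]
    push_cast
    ring
  rw [this]
  ring

lemma conj_mem_sector (hk : 0 < k) {s : ℤ} {z : ℂ} (hz : z ∈ sector k s) :
    starRingEnd ℂ z ∈ sector k (-s - 1) := by
  obtain ⟨u, hu, rfl⟩ := (mem_sector_iff hk).mp hz
  refine (mem_sector_iff hk).mpr ⟨starRingEnd ℂ u + Real.pi * I, ⟨?_, ?_⟩, ?_⟩
  · simpa using hu.2
  · simpa using hu.1
  · rw [← exp_conj]
    simp only [map_div₀, map_add, map_mul, conj_ofReal, conj_I, map_natCast, map_intCast]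
    congr 1
    push_cast
    ring

lemma exists_sector_of_im_pos (hk : 0 < k) {z : ℂ} (hz : 0 < (z ^ k).im) :
    ∃ u ∈ piStrip, ∃ m : ℤ, z = exp ((u + 2 * Real.pi * m * I) / k) := by
  have hz1 : z ^ k ≠ 0 := fun h => by rw [h, zero_im] at hz; exact lt_irrefl _ hz
  have hz0 : z ≠ 0 := fun h => hz1 (by rw [h, zero_pow hk.ne'])
  have hk' : (k : ℂ) ≠ 0 := Nat.cast_ne_zero.mpr hk.ne'
  have h0 : exp ((k : ℂ) * log z) = exp (log (z ^ k)) := by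
    rw [exp_log hz1, exp_nat_mul, exp_log hz0]
  obtain ⟨m, hm⟩ := exp_eq_exp_iff_exists_int.mp h0
  refine ⟨log (z ^ k), ⟨?_, ?_⟩, m, ?_⟩
  · rw [log_im]
    refine (arg_nonneg_iff.mpr hz.le).lt_of_ne fun h => ?_
    rw [eq_comm, arg_eq_zero_iff] at h
    exact hz.ne' h.2
  · rw [log_im]
    refine (arg_le_pi _).lt_of_ne fun h => ?_
    exact hz.ne' (arg_eq_pi_iff.mp h).2
  · rw [← exp_log hz0]
    congr 1
    rw [eq_div_iff hk', mul_comm, exp_log hz0, hm]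
    ring

lemma norm_exp_div (u : ℂ) (x : ℝ) : ‖exp ((u + x * I) / k)‖ = Real.exp (u.re / k) := by
  rw [norm_exp, ← ofReal_natCast, div_ofReal_re]
  simp

lemma norm_exp_sector (u : ℂ) (m : ℤ) :
    ‖exp ((u + 2 * Real.pi * m * I) / k)‖ = Real.exp (u.re / k) := by
  rw [← norm_exp_div u (2 * Real.pi * m)]
  push_cast
  rfl

lemma re_lt_re_iff_norm_lt (hk : 0 < k) (u v : ℂ) (m n : ℤ) :
    ‖exp ((u + 2 * Real.pi * m * I) / k)‖ < ‖exp ((v + 2 * Real.pi * n * I) / k)‖ ↔ u.re < v.re := by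
  rw [norm_exp_sector, norm_exp_sector, Real.exp_lt_exp,
    div_lt_div_iff_of_pos_right (Nat.cast_pos.mpr hk)]

end sectors

/-! ### From one `α`-point to the next -/

section alphaPoints

variable {k : ℕ} {p : ℤ} {G L : ℂ → ℂ} {α : ℂ}

lemma level_eq (hk : 0 < k)
    (hG : ∀ u ∈ piStrip, ∀ m : ℤ, G (exp ((u + 2 * Real.pi * m * I) / k)) =
      exp ((L u + 2 * Real.pi * (m * p) * I) / k))
    {u γ : ℂ} (hu : u ∈ piStrip) {m r : ℤ}
    (h : G (exp ((u + 2 * Real.pi * m * I) / k)) = exp ((γ + Real.pi * r * I) / k)) :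
    ∃ j : ℤ, (L u).re = γ.re ∧ (L u).im = γ.im + Real.pi * (r - 2 * (m * p) + 2 * (k * j)) := by
  rw [hG u hu m] at h
  obtain ⟨j, hj⟩ := (exp_div_eq_exp_div_iff hk).mp h
  have h1 := congrArg re hj
  have h2 := congrArg im hj
  simp at h1 h2
  exact ⟨j, h1, by linarith⟩

/-- The passage from an `α`-point `z` with `Im z ^ k > 0` to the following one. -/
lemma exists_sector_next (hk : 0 < k) (hpk : IsCoprime p (k : ℤ))
    (hG : ∀ u ∈ piStrip, ∀ m : ℤ, G (exp ((u + 2 * Real.pi * m * I) / k)) =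
      exp ((L u + 2 * Real.pi * (m * p) * I) / k))
    (hconj : ∀ z, G (starRingEnd ℂ z) = starRingEnd ℂ (G z))
    (hreal : ∀ z : ℂ, (z ^ k).im = 0 → (G z ^ k).im = 0)
    (hL : ∀ u ∈ piStrip, ∃ D, HasDerivAt L D u ∧ 0 < D.im)
    (hlevel : ∀ u ∈ piStrip, ∀ v ∈ piStrip, (L u).re = (L v).re → ∀ s : ℝ, (L u).im < s →
      s < (L v).im → Real.sin s ≠ 0 → ∃ x ∈ piStrip, (L x).re = (L u).re ∧ (L x).im = s)
    (hα : (α ^ k).im ≠ 0) {z z' : ℂ} (hzz : ConsecutiveAlphaPoints G α z z') {q m ϰ : ℤ}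
    (hαs : α ∈ sector k (2 * q - ϰ)) (hzs : z ∈ sector k (2 * m)) :
    ∃ n j : ℤ, z' ∈ sector k (2 * n - 1) ∧ p * (n + m) = 2 * q + 1 - ϰ + k * j := by
  obtain ⟨hz, hz', hlt, hbet⟩ := hzz
  obtain ⟨γ, hγ, hαγ⟩ := (mem_sector_iff hk).mp hαs
  obtain ⟨u, hu, hzu⟩ := (mem_sector_iff hk).mp hzs
  replace hzu : z = exp ((u + 2 * Real.pi * m * I) / k) := by
    rw [hzu]; congr 2; push_cast; ring
  have hpi := Real.pi_pos
  have hz0 : G z = α := hz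
  have hz0' : G z' = α := hz'
  obtain ⟨j, hure, huim⟩ := level_eq hk hG hu (hzu ▸ hz0.trans hαγ)
  -- The first value above `Im L u` in the class of the conjugated `α`-points; `0 < γ.im < π` puts
  -- it strictly between `Im L u` and `Im L u + 2π`.
  set s := (L u).im + 2 * Real.pi - 2 * γ.im with hs
  have hsin : Real.sin s ≠ 0 := by
    have : s = -γ.im + (2 * q - ϰ - 2 * (m * p) + 2 * (k * j) + 2 : ℤ) * Real.pi := by
      rw [hs, huim]; push_cast; ring
    rw [this, Real.sin_add_int_mul_pi, Real.sin_neg]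
    exact mul_ne_zero (zpow_ne_zero _ (by norm_num))
      (neg_ne_zero.mpr (Real.sin_pos_of_pos_of_lt_pi hγ.1 hγ.2).ne')
  have hnext : ∀ v ∈ piStrip, (L v).re = γ.re → (∃ i : ℤ, ‖z'‖ = ‖exp ((v + 2 * Real.pi * i * I) / k)‖) →
      (L v).im ≤ s := by
    intro v hv hvre ⟨i, hi⟩
    by_contra! hsv
    obtain ⟨x, hx, hxre, hxim⟩ := hlevel u hu v hv (by rw [hure, hvre]) s
      (by rw [hs]; linarith [hγ.2]) hsv hsin
    have hx1 := (im_lt_im_iff_re_lt_re hL hu hx hxre.symm).mp (by rw [hxim, hs]; linarith [hγ.2])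
    have hx2 := (im_lt_im_iff_re_lt_re hL hx hv (by rw [hxre, hure, hvre])).mp (by rwa [hxim])
    -- Bézout supplies a sheet: index `N * e` satisfies `(N * e) * p ≡ N` mod `k`. Over `x` on that
    -- sheet lies the conjugate of an `α`-point strictly between `z` and `z'` in absolute value.
    obtain ⟨e, f, hef⟩ := hpk
    set N : ℤ := -2 * q + ϰ - 1 + m * p - k * j with hN
    have hbez : (N * e) * p - k * (-(N * f)) = N := by linear_combination N * hef
    have hζ : G (starRingEnd ℂ (exp ((x + 2 * Real.pi * (N * e : ℤ) * I) / k))) = α := by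
      rw [hconj, hG x hx, hαγ]
      have h3 : exp ((L x + 2 * Real.pi * ((N * e : ℤ) * p) * I) / k) =
          exp ((starRingEnd ℂ γ - Real.pi * (2 * q - ϰ : ℤ) * I) / k) := by
        refine (exp_div_eq_exp_div_iff hk).mpr ⟨-(N * f), ?_⟩
        have hbez' : ((N * e : ℤ) : ℝ) * p - k * ((-(N * f) : ℤ) : ℝ) = N := by exact_mod_cast hbez
        have hN' : (N : ℝ) = -2 * q + ϰ - 1 + m * p - k * j := by rw [hN]; push_cast; ring
        apply Complex.ext
        · simp [hxre, hure]
        · simp only [add_im, sub_im, mul_im, mul_re, ofReal_re, ofReal_im, intCast_re, intCast_im,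
            natCast_re, natCast_im, I_re, I_im, conj_im, re_ofNat, im_ofNat]
          rw [hxim, hs, huim]
          push_cast at hbez' ⊢
          linear_combination 2 * Real.pi * hbez' + 2 * Real.pi * hN'
      rw [h3, ← exp_conj]
      simp only [map_div₀, map_sub, map_mul, conj_ofReal, conj_I, map_natCast, map_intCast, conj_conj]
      congr 2
      ring
    refine hbet _ hζ ⟨?_, ?_⟩
    · rw [RCLike.norm_conj, hzu]
      exact (re_lt_re_iff_norm_lt hk _ _ _ _).mpr hx1
    · rw [RCLike.norm_conj, hi]
      exact (re_lt_re_iff_norm_lt hk _ _ _ _).mpr hx2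
  rcases lt_trichotomy (z' ^ k).im 0 with him | him | him
  · obtain ⟨v, hv, n, hn⟩ := exists_sector_of_im_pos (z := starRingEnd ℂ z') hk
      (by rw [← map_pow, conj_im]; linarith)
    have hGn : G (exp ((v + 2 * Real.pi * n * I) / k)) =
        exp ((starRingEnd ℂ γ + Real.pi * (-(2 * q - ϰ) : ℤ) * I) / k) := by
      rw [← hn, hconj, hz0', hαγ, ← exp_conj]
      simp only [map_div₀, map_add, map_mul, conj_ofReal, conj_I, map_natCast, map_intCast]
      congr 2
      push_cast
      ring
    obtain ⟨j', hvre, hvim⟩ := level_eq hk hG hv hGn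
    rw [conj_re] at hvre
    rw [conj_im] at hvim
    have hnorm : ‖z'‖ = ‖exp ((v + 2 * Real.pi * n * I) / k)‖ := by rw [← hn, RCLike.norm_conj]
    have h1 := hnext v hv hvre ⟨n, hnorm⟩
    have h2 := (im_lt_im_iff_re_lt_re hL hu hv (hure.trans hvre.symm)).mpr
      ((re_lt_re_iff_norm_lt hk _ _ _ _).mp (hzu ▸ hnorm ▸ hlt))
    -- `Im L v` and `s` differ by `2π M`. The bound by `s` gives `M ≤ 0` and the order of the points
    -- gives `M > -1`, so `M = 0`, which is the congruence.
    obtain ⟨M, hM⟩ : ∃ M : ℤ, M = -2 * q + ϰ - n * p + k * j' - 1 + m * p - k * j := ⟨_, rfl⟩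
    have hM' : (M : ℝ) = -2 * q + ϰ - n * p + k * j' - 1 + m * p - k * j := by
      rw [hM]; push_cast; ring
    have h3 : (L v).im = s + 2 * Real.pi * M := by
      rw [hvim, hs, huim, hM']; push_cast; ring
    have hM0 : M ≤ 0 := by
      have : Real.pi * (M : ℝ) ≤ 0 := by linarith
      exact_mod_cast nonpos_of_mul_nonpos_right this hpi
    have hM1 : -1 < M := by
      have : 0 < Real.pi * ((M : ℝ) + 1) := by
        rw [h3, hs] at h2
        linarith [hγ.1]
      have := pos_of_mul_pos_right this hpi.le
      exact_mod_cast (by linarith : (-1 : ℝ) < M)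
    refine ⟨-n, j - j', ?_, ?_⟩
    · have : starRingEnd ℂ z' ∈ sector k (2 * n) := by
        refine (mem_sector_iff hk).mpr ⟨v, hv, ?_⟩
        rw [hn]; congr 2; push_cast; ring
      have := conj_mem_sector hk this
      rw [conj_conj] at this
      convert this using 2
      ring
    · have : M = 0 := by omega
      rw [this] at hM
      linear_combination -hM
  · exact absurd (hz0' ▸ hreal z' him) hα
  -- In the same half-plane `Im L` would grow by at least `2π`, which overshoots `s`.
  · obtain ⟨v, hv, n, hn⟩ := exists_sector_of_im_pos hk him
    obtain ⟨j', hvre, hvim⟩ := level_eq hk hG hv (hn ▸ hz0'.trans hαγ)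
    have h1 := hnext v hv hvre ⟨n, by rw [← hn]⟩
    have h2 := (im_lt_im_iff_re_lt_re hL hu hv (hure.trans hvre.symm)).mpr
      ((re_lt_re_iff_norm_lt hk _ _ _ _).mp (hzu ▸ hn ▸ hlt))
    obtain ⟨M, hM⟩ : ∃ M : ℤ, M = - n * p + k * j' + m * p - k * j := ⟨_, rfl⟩
    have hM' : (M : ℝ) = - n * p + k * j' + m * p - k * j := by
      rw [hM]; push_cast; ring
    have h3 : (L v).im = (L u).im + 2 * Real.pi * M := by
      rw [hvim, huim, hM']; push_cast; ring
    have hM0 : 0 < M := by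
      have : 0 < Real.pi * (M : ℝ) := by linarith
      exact_mod_cast pos_of_mul_pos_right this hpi.le
    have hM1 : (1 : ℝ) ≤ M := by exact_mod_cast hM0
    have h4 := mul_le_mul_of_nonneg_left hM1 hpi.le
    linarith [hγ.1]

end alphaPoints

/-! ### Congruence for the sectors, uniqueness and simplicity -/

section alphaPoints

variable {k : ℕ} {p : ℤ} {G L : ℂ → ℂ} {α : ℂ}

lemma ConsecutiveAlphaPoints.conj {z z' : ℂ} (hconj : ∀ z, G (starRingEnd ℂ z) = starRingEnd ℂ (G z))
    (h : ConsecutiveAlphaPoints G α z z') :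
    ConsecutiveAlphaPoints G (starRingEnd ℂ α) (starRingEnd ℂ z) (starRingEnd ℂ z') := by
  obtain ⟨h1, h2, h3, h4⟩ := h
  have key : ∀ z, G z = α → G (starRingEnd ℂ z) = starRingEnd ℂ α := fun z hz => by rw [hconj, hz]
  refine ⟨key z h1, key z' h2, by simpa only [RCLike.norm_conj] using h3, fun ζ hζ => ?_⟩
  have hζ' : G (starRingEnd ℂ ζ) = α := by
    rw [hconj, show G ζ = starRingEnd ℂ α from hζ, conj_conj]
  simpa only [RCLike.norm_conj] using h4 _ hζ'

/-- Since `p` is invertible mod `k`, solutions `l` differ by multiples of `k`, hence sector indices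
by multiples of `2k`. -/
lemma exists_and_forall_sector (hk : 0 < k) (hpk : IsCoprime p (k : ℤ)) {z : ℂ} {n m j r σ : ℤ}
    (hz : z ∈ sector k (2 * n - 1 + σ)) (h : p * (n + m) = r + k * j) :
    (∃ l : ℤ, p * (l + m) ≡ r [ZMOD (k : ℤ)]) ∧
      ∀ l : ℤ, p * (l + m) ≡ r [ZMOD (k : ℤ)] → z ∈ sector k (2 * l - 1 + σ) := by
  refine ⟨⟨n, (Int.modEq_iff_dvd.mpr ⟨j, by rw [h]; ring⟩ : r ≡ p * (n + m) [ZMOD (k : ℤ)]).symm⟩,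
    fun l hl => ?_⟩
  obtain ⟨i, hi⟩ := Int.modEq_iff_dvd.mp hl
  have h1 : (k : ℤ) ∣ n - l := by
    refine hpk.symm.dvd_of_dvd_mul_left (show (k : ℤ) ∣ p * (n - l) from ⟨i + j, ?_⟩)
    linear_combination hi + h
  obtain ⟨t, ht⟩ := h1
  exact sector_subset_of_dvd hk ⟨t, by linear_combination 2 * ht⟩ hz

lemma sector_of_consecutive (hk : 0 < k) (hpk : IsCoprime p (k : ℤ))
    (hG : ∀ u ∈ piStrip, ∀ m : ℤ, G (exp ((u + 2 * Real.pi * m * I) / k)) =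
      exp ((L u + 2 * Real.pi * (m * p) * I) / k))
    (hconj : ∀ z, G (starRingEnd ℂ z) = starRingEnd ℂ (G z))
    (hreal : ∀ z : ℂ, (z ^ k).im = 0 → (G z ^ k).im = 0)
    (hL : ∀ u ∈ piStrip, ∃ D, HasDerivAt L D u ∧ 0 < D.im)
    (hlevel : ∀ u ∈ piStrip, ∀ v ∈ piStrip, (L u).re = (L v).re → ∀ s : ℝ, (L u).im < s →
      s < (L v).im → Real.sin s ≠ 0 → ∃ x ∈ piStrip, (L x).re = (L u).re ∧ (L x).im = s)
    (hα : (α ^ k).im ≠ 0) {z z' : ℂ} (hzz : ConsecutiveAlphaPoints G α z z') {q m ϰ σ : ℤ}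
    (hσ : σ = 0 ∨ σ = 1) (hαs : α ∈ sector k (2 * q - ϰ)) (hzs : z ∈ sector k (2 * m - σ)) :
    (∃ l : ℤ, p * (l + m) ≡ 2 * q + 1 - ϰ - σ [ZMOD (k : ℤ)]) ∧
      ∀ l : ℤ, p * (l + m) ≡ 2 * q + 1 - ϰ - σ [ZMOD (k : ℤ)] →
        z' ∈ sector k (2 * l - 1 + σ) := by
  rcases hσ with rfl | rfl
  · rw [sub_zero] at hzs
    obtain ⟨n, j, h1, h2⟩ := exists_sector_next hk hpk hG hconj hreal hL hlevel hα hzz hαs hzs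
    exact exists_and_forall_sector hk hpk (n := n) (j := j) (by rwa [add_zero])
      (by rw [h2, sub_zero])
  -- The case `σ = 1` is the case `σ = 0` for the conjugated points, with `q, m, ϰ` replaced by `-q,
  -- -m, 1 - ϰ`.
  · have e1 : starRingEnd ℂ α ∈ sector k (2 * -q - (1 - ϰ)) := by
      convert conj_mem_sector hk hαs using 2
      ring
    have e2 : starRingEnd ℂ z ∈ sector k (2 * -m) := by
      convert conj_mem_sector hk hzs using 2
      ring
    have e3 : ((starRingEnd ℂ α) ^ k).im ≠ 0 := by
      rw [← map_pow, conj_im]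
      exact neg_ne_zero.mpr hα
    obtain ⟨n, j, h1, h2⟩ := exists_sector_next hk hpk hG hconj hreal hL hlevel e3 (hzz.conj hconj)
      e1 e2
    have h3 := conj_mem_sector hk h1
    rw [conj_conj] at h3
    refine exists_and_forall_sector hk hpk (n := -n) (j := -j) ?_ (by linear_combination -h2)
    convert h3 using 2
    ring

/-- An `α`-point with `Im z ^ k > 0` is determined by its absolute value. -/
lemma eq_of_norm_eq_of_im_pos (hk : 0 < k) (hpk : IsCoprime p (k : ℤ))
    (hG : ∀ u ∈ piStrip, ∀ m : ℤ, G (exp ((u + 2 * Real.pi * m * I) / k)) =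
      exp ((L u + 2 * Real.pi * (m * p) * I) / k))
    (hL : ∀ u ∈ piStrip, ∃ D, HasDerivAt L D u ∧ 0 < D.im) {z z' : ℂ} (h : ‖G z'‖ = ‖G z‖)
    (hn : ‖z'‖ = ‖z‖) (hz : 0 < (z ^ k).im) (hz' : 0 < (z' ^ k).im) :
    z' ^ k = z ^ k ∧ (G z' = G z → z' = z) := by
  obtain ⟨u, hu, m, rfl⟩ := exists_sector_of_im_pos hk hz
  obtain ⟨v, hv, n, rfl⟩ := exists_sector_of_im_pos hk hz'
  have hk0 : (k : ℝ) ≠ 0 := Nat.cast_ne_zero.mpr hk.ne'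
  have h1 : v.re = u.re := by
    rw [norm_exp_sector, norm_exp_sector, Real.exp_eq_exp] at hn
    exact (div_left_inj' hk0).mp hn
  have h2 : (L v).re = (L u).re := by
    rw [hG u hu, hG v hv] at h
    have := norm_exp_sector (k := k) (L v) (n * p)
    have := norm_exp_sector (k := k) (L u) (m * p)
    push_cast at *
    simp_all [Real.exp_eq_exp, div_left_inj' hk0]
  obtain rfl := eq_of_re_eq hL hv hu h1 h2
  have hk' : (k : ℂ) ≠ 0 := Nat.cast_ne_zero.mpr hk.ne'
  have hpow : ∀ i : ℤ, exp ((v + 2 * Real.pi * i * I) / k) ^ k = exp v := fun i => by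
    rw [← exp_nat_mul, mul_div_cancel₀ _ hk', exp_eq_exp_iff_exists_int]
    exact ⟨i, by ring⟩
  refine ⟨by rw [hpow, hpow], fun hGG => ?_⟩
  rw [hG v hv, hG v hv] at hGG
  obtain ⟨j, hj⟩ := (exp_div_eq_exp_div_iff hk).mp hGG
  have h3 : (n * p : ℂ) = m * p + k * j := by
    have h4 : 2 * Real.pi * I * ((n * p : ℂ) - (m * p + k * j)) = 0 := by linear_combination hj
    exact sub_eq_zero.mp ((mul_eq_zero.mp h4).resolve_left two_pi_I_ne_zero)
  have h5 : n * p = m * p + k * j := by exact_mod_cast h3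
  obtain ⟨t, ht⟩ : (k : ℤ) ∣ n - m :=
    hpk.symm.dvd_of_dvd_mul_left
      (show (k : ℤ) ∣ p * (n - m) from ⟨j, by linear_combination h5⟩)
  refine (exp_div_eq_exp_div_iff hk).mpr ⟨t, ?_⟩
  have ht' : (n : ℂ) = m + k * t := by
    rw [eq_add_of_sub_eq' ht]
    push_cast
    ring
  rw [ht']
  ring

lemma eq_of_norm_eq (hk : 0 < k) (hpk : IsCoprime p (k : ℤ))
    (hG : ∀ u ∈ piStrip, ∀ m : ℤ, G (exp ((u + 2 * Real.pi * m * I) / k)) =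
      exp ((L u + 2 * Real.pi * (m * p) * I) / k))
    (hconj : ∀ z, G (starRingEnd ℂ z) = starRingEnd ℂ (G z))
    (hL : ∀ u ∈ piStrip, ∃ D, HasDerivAt L D u ∧ 0 < D.im)
    (hpow : ∀ z z' : ℂ, z' ^ k = z ^ k → G z' ^ k = G z ^ k)
    (hα : (α ^ k).im ≠ 0) {z z' : ℂ} (hz : G z = α) (hz' : G z' = α)
    (hn : ‖z'‖ = ‖z‖) (hi : (z ^ k).im ≠ 0) (hi' : (z' ^ k).im ≠ 0) : z' = z := by
  have hneg : ∀ {w : ℂ}, (w ^ k).im < 0 → 0 < (starRingEnd ℂ w ^ k).im := fun hw => by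
    rw [← map_pow, conj_im]
    linarith
  have hmix : ∀ {w w' : ℂ}, G w = α → G w' = α → ‖w'‖ = ‖w‖ → 0 < (w ^ k).im →
      (w' ^ k).im < 0 → False := by
    intro w w' hw hw' hn h h'
    have h1 := (eq_of_norm_eq_of_im_pos hk hpk hG hL (z' := starRingEnd ℂ w')
      (by rw [hconj, RCLike.norm_conj, hw, hw']) (by rw [RCLike.norm_conj, hn]) h (hneg h')).1
    -- The `k`-th powers of `conj w'` and `w` agree, hence so do those of `conj α` and `α`, which
    -- makes `α ^ k` real.
    have h2 := hpow _ _ h1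
    rw [hconj, hw, hw', ← map_pow, conj_eq_iff_im] at h2
    exact hα h2
  rcases lt_or_gt_of_ne hi with h | h <;> rcases lt_or_gt_of_ne hi' with h' | h'
  · refine (starRingEnd ℂ).injective ((eq_of_norm_eq_of_im_pos hk hpk hG hL ?_ ?_
      (hneg h) (hneg h')).2 ?_)
    · rw [hconj, hconj, hz, hz']
    · rw [RCLike.norm_conj, RCLike.norm_conj, hn]
    · rw [hconj, hconj, hz, hz']
  · exact (hmix hz' hz hn.symm h' h).elim
  · exact (hmix hz hz' hn h h').elim
  · exact (eq_of_norm_eq_of_im_pos hk hpk hG hL (by rw [hz, hz']) hn h h').2 (by rw [hz, hz'])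

/-- In the coordinate `u` the derivative is a nonzero factor times `L'`, and `L'` cannot vanish
because `Im L' > 0`. -/
lemma deriv_ne_zero_of_im_pos (hk : 0 < k)
    (hG : ∀ u ∈ piStrip, ∀ m : ℤ, G (exp ((u + 2 * Real.pi * m * I) / k)) =
      exp ((L u + 2 * Real.pi * (m * p) * I) / k))
    (hL : ∀ u ∈ piStrip, ∃ D, HasDerivAt L D u ∧ 0 < D.im) {z : ℂ} (hz : 0 < (z ^ k).im)
    (hd : DifferentiableAt ℂ G z) : deriv G z ≠ 0 := by
  obtain ⟨u, hu, m, rfl⟩ := exists_sector_of_im_pos hk hz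
  have hk' : (k : ℂ) ≠ 0 := Nat.cast_ne_zero.mpr hk.ne'
  intro h0
  obtain ⟨D, hD, hDpos⟩ := hL u hu
  have h1 : HasDerivAt (fun u : ℂ => exp ((u + 2 * Real.pi * m * I) / k))
      (exp ((u + 2 * Real.pi * m * I) / k) * (1 / k)) u :=
    (((hasDerivAt_id u).add_const _).div_const _).cexp
  have h2 := hd.hasDerivAt.comp u h1
  rw [h0, zero_mul] at h2
  have h3 : HasDerivAt (fun u : ℂ => exp ((L u + 2 * Real.pi * (m * p) * I) / k))
      (exp ((L u + 2 * Real.pi * (m * p) * I) / k) * (D / k)) u :=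
    ((hD.add_const _).div_const _).cexp
  have h4 : (G ∘ fun u : ℂ => exp ((u + 2 * Real.pi * m * I) / k)) =ᶠ[𝓝 u]
      fun u : ℂ => exp ((L u + 2 * Real.pi * (m * p) * I) / k) := by
    filter_upwards [isOpen_piStrip.mem_nhds hu] with v hv using hG v hv m
  have h5 := h3.unique (h2.congr_of_eventuallyEq h4.symm)
  have hD0 : D ≠ 0 := fun h => by rw [h, zero_im] at hDpos; exact lt_irrefl _ hDpos
  exact mul_ne_zero (exp_ne_zero _) (div_ne_zero hD0 hk') h5

lemma isSimpleAlphaPoint_of_im_ne_zero (hk : 0 < k)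
    (hG : ∀ u ∈ piStrip, ∀ m : ℤ, G (exp ((u + 2 * Real.pi * m * I) / k)) =
      exp ((L u + 2 * Real.pi * (m * p) * I) / k))
    (hconj : ∀ z, G (starRingEnd ℂ z) = starRingEnd ℂ (G z))
    (hL : ∀ u ∈ piStrip, ∃ D, HasDerivAt L D u ∧ 0 < D.im)
    (han : ∀ z, G z ≠ 0 → AnalyticAt ℂ G z) {z : ℂ} (hz : (z ^ k).im ≠ 0) (hα : G z ≠ 0) :
    IsSimpleAlphaPoint G (G z) z := by
  refine ⟨le_rfl, rfl, han z hα, fun j h1 h2 => absurd h1 (by omega), ?_⟩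
  rw [iteratedDeriv_one]
  rcases lt_or_gt_of_ne hz with h | h
  · have h1 : G = starRingEnd ℂ ∘ G ∘ starRingEnd ℂ := by
      funext w
      simp [hconj]
    have h2 := deriv_ne_zero_of_im_pos hk hG hL (z := starRingEnd ℂ z)
      (by rw [← map_pow, conj_im]; linarith)
      (han _ (by rw [hconj]; exact (map_ne_zero _).mpr hα)).differentiableAt
    rw [h1, deriv_conj_conj]
    exact (map_ne_zero _).mpr h2
  · exact deriv_ne_zero_of_im_pos hk hG hL h (han z hα).differentiableAt

end alphaPoints

/-! ### Application to `G` -/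

section genFun

variable {ι₁ ι₂ ι₃ ι₄ : Type*} {p : ℤ} {k : ℕ} {A A₀ : ℝ} {a : ι₁ → ℝ} {b : ι₂ → ℝ} {c : ι₃ → ℝ}
  {d : ι₄ → ℝ}

lemma powComp_exp (hk : 0 < k)
    (ha : ∀ ν, 0 < a ν) (hb : ∀ μ, 0 < b μ) (hc : ∀ ν, 0 < c ν) (hd : ∀ μ, 0 < d μ)
    (hsa : Summable fun ν => (a ν)⁻¹) (hsb : Summable fun μ => (b μ)⁻¹)
    (hsc : Summable fun ν => (c ν)⁻¹) (hsd : Summable fun μ => (d μ)⁻¹) {u : ℂ} (hu : u ∈ piStrip)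
    (m : ℤ) : powComp p k A A₀ a b c d (exp ((u + 2 * Real.pi * m * I) / k)) =
      exp ((p * u + k * logGen A A₀ a b c d u + 2 * Real.pi * (m * p) * I) / k) := by
  have hk' : (k : ℂ) ≠ 0 := Nat.cast_ne_zero.mpr hk.ne'
  have h1 : exp ((u + 2 * Real.pi * m * I) / k) ^ k = exp u := by
    rw [← exp_nat_mul, mul_div_cancel₀ _ hk', exp_eq_exp_iff_exists_int]
    exact ⟨m, by ring⟩
  rw [powComp, h1, ← exp_logGen ha hb hc hd hsa hsb hsc hsd hu, ← exp_int_mul, ← exp_add]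
  congr 1
  field_simp
  ring

lemma exists_mem_level_logGen {L : ℂ → ℂ} (hLdef : ∀ u, L u = p * u + k * logGen A A₀ a b c d u)
    (ha : ∀ ν, 0 < a ν) (hb : ∀ μ, 0 < b μ) (hc : ∀ ν, 0 < c ν) (hd : ∀ μ, 0 < d μ)
    (hsa : Summable fun ν => (a ν)⁻¹) (hsb : Summable fun μ => (b μ)⁻¹)
    (hsc : Summable fun ν => (c ν)⁻¹) (hsd : Summable fun μ => (d μ)⁻¹)
    (hL : ∀ u ∈ piStrip, ∃ D, HasDerivAt L D u ∧ 0 < D.im) {u v : ℂ} (hu : u ∈ piStrip)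
    (hv : v ∈ piStrip) (huv : (L u).re = (L v).re) {s : ℝ} (h1 : (L u).im < s) (h2 : s < (L v).im)
    (hs : Real.sin s ≠ 0) : ∃ x ∈ piStrip, (L x).re = (L u).re ∧ (L x).im = s := by
  have ca := (differentiable_facProd hsa).continuous
  have cb := (differentiable_facProd hsb).continuous
  have cc := (differentiable_facProd hsc).continuous
  have cd := (differentiable_facProd hsd).continuous
  -- `exp L = N / M` is `G ^ k` as a function of `w`. The zeros of `N` off the origin lie on the
  -- negative axis and those of `M` on the positive axis, so `N` is nonzero on the edge `Im u = 0`
  -- and `M` on the edge `Im u = π`.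
  set N : ℂ → ℂ := fun w => w ^ p * (exp (A * w + A₀ * w⁻¹) * (facProd a w * facProd c w⁻¹)) ^ k
    with hN
  set M : ℂ → ℂ := fun w => (facProd b (-w) * facProd d (-w⁻¹)) ^ k with hM
  have hNc : ∀ w, N (starRingEnd ℂ w) = starRingEnd ℂ (N w) := fun w => by
    simp only [hN, map_mul, map_zpow₀, map_pow, ← facProd_conj, ← exp_conj, map_add, conj_ofReal,
      map_inv₀]
  have hMc : ∀ w, M (starRingEnd ℂ w) = starRingEnd ℂ (M w) := fun w => by
    simp only [hM, map_mul, map_pow, ← facProd_conj, map_inv₀, map_neg]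
  have hre : ∀ u : ℂ, (u.im = 0 ∨ u.im = Real.pi) → starRingEnd ℂ (exp u) = exp u := fun u hu => by
    rw [conj_eq_iff_im, exp_im]
    rcases hu with h | h <;> simp [h]
  have hinv : Continuous fun u : ℂ => (exp u)⁻¹ := continuous_exp.inv₀ exp_ne_zero
  refine exists_mem_level (n := fun u => N (exp u)) (d := fun u => M (exp u)) hL ?_ ?_ ?_ ?_ ?_ ?_ ?_
    hu hv huv h1 h2 hs
  · refine (continuous_exp.zpow₀ p fun u => Or.inl (exp_ne_zero u)).mul (Continuous.pow ?_ k)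
    exact (((continuous_const.mul continuous_exp).add (continuous_const.mul hinv)).cexp).mul
      ((ca.comp continuous_exp).mul (cc.comp hinv))
  · exact ((cb.comp continuous_exp.neg).mul (cd.comp hinv.neg)).pow k
  · intro u hu
    have h := exp_logGen (A := A) (A₀ := A₀) ha hb hc hd hsa hsb hsc hsd hu
    have e1 := exp_im_pos hu
    have e2 := exp_neg_im_neg hu
    have hb0 : facProd b (-exp u) ≠ 0 := by
      rw [← exp_logSum hb hsb (by rw [neg_im]; linarith)]
      exact exp_ne_zero _
    have hd0 : facProd d (-(exp u)⁻¹) ≠ 0 := by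
      rw [← exp_neg, ← exp_logSum hd hsd (by rw [neg_im]; linarith)]
      exact exp_ne_zero _
    rw [hLdef, exp_add, exp_int_mul, exp_nat_mul, h, genFun_eq, mul_assoc, ← mul_pow]
    simp only [hN]
    generalize facProd d (-(exp u)⁻¹) = x at hd0 ⊢
    generalize facProd c (exp u)⁻¹ = y
    congr 2
    field_simp
  · intro u hu
    rw [← conj_eq_iff_im, ← hNc, hre u hu]
  · intro u hu
    rw [← conj_eq_iff_im, ← hMc, hre u hu]
  · intro u hu
    have e : exp u = (Real.exp u.re : ℂ) := by
      rw [ofReal_exp]; congr 1; exact Complex.ext rfl (by simpa using hu)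
    simp only [hN, e, ← ofReal_inv]
    have := Real.exp_pos u.re
    exact mul_ne_zero (zpow_ne_zero _ (ofReal_ne_zero.mpr this.ne')) (pow_ne_zero _
      (mul_ne_zero (exp_ne_zero _) (mul_ne_zero (facProd_ne_zero_of_pos ha hsa this)
        (facProd_ne_zero_of_pos hc hsc (inv_pos.mpr this)))))
  · intro u hu
    have e : -exp u = (Real.exp u.re : ℂ) := by
      rw [← re_add_im u, hu, exp_add, exp_pi_mul_I]; simp
    have e' : -(exp u)⁻¹ = ((Real.exp u.re)⁻¹ : ℝ) := by
      rw [ofReal_inv, ← e, inv_neg]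
    simp only [hM, e, e']
    have := Real.exp_pos u.re
    exact pow_ne_zero _ (mul_ne_zero (facProd_ne_zero_of_pos hb hsb this)
      (facProd_ne_zero_of_pos hd hsd (inv_pos.mpr this)))

lemma powComp_pow_eq {z z' : ℂ} (h : z' ^ k = z ^ k) :
    powComp p k A A₀ a b c d z' ^ k = powComp p k A A₀ a b c d z ^ k := by
  have key : ∀ z : ℂ, (z ^ p) ^ k = (z ^ k) ^ p := fun z => by
    rw [← zpow_natCast, ← zpow_natCast, zpow_comm]
  rw [powComp, powComp, mul_pow, mul_pow, key, key, h]

end genFun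

theorem mainTheorem1 {ι₁ ι₂ ι₃ ι₄ : Type*} (k : ℕ) (hk : 2 ≤ k) (p : ℤ)
    (hpk : Nat.gcd p.natAbs k = 1) (A A₀ : ℝ) (hA : 0 ≤ A) (hA₀ : 0 ≤ A₀)
    (a : ι₁ → ℝ) (b : ι₂ → ℝ) (c : ι₃ → ℝ) (d : ι₄ → ℝ)
    (ha : ∀ ν, 0 < a ν) (hb : ∀ μ, 0 < b μ) (hc : ∀ ν, 0 < c ν) (hd : ∀ μ, 0 < d μ)
    (hsa : Summable fun ν => (a ν)⁻¹) (hsb : Summable fun μ => (b μ)⁻¹)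
    (hsc : Summable fun ν => (c ν)⁻¹) (hsd : Summable fun μ => (d μ)⁻¹)
    (hG : ∃ z : ℂ, z ≠ 0 ∧ powComp p k A A₀ a b c d z ≠ z ^ p)
    (α : ℂ) (hα : (α ^ k).im ≠ 0) :
    (∀ z ∈ alphaSet (powComp p k A A₀ a b c d) α,
      IsSimpleAlphaPoint (powComp p k A A₀ a b c d) α z ∧
      (z ^ k).im ≠ 0 ∧
      ∀ z' ∈ alphaSet (powComp p k A A₀ a b c d) α, ‖z'‖ = ‖z‖ → z' = z) ∧
    (∀ z z' : ℂ, ConsecutiveAlphaPoints (powComp p k A A₀ a b c d) α z z' →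
      ∀ q m ϰ σ : ℤ, (ϰ = 0 ∨ ϰ = 1) → (σ = 0 ∨ σ = 1) →
        α ∈ sector k (2 * q - ϰ) → z ∈ sector k (2 * m - σ) →
        (∃ l : ℤ, p * (l + m) ≡ 2 * q + 1 - ϰ - σ [ZMOD (k : ℤ)]) ∧
        ∀ l : ℤ, p * (l + m) ≡ 2 * q + 1 - ϰ - σ [ZMOD (k : ℤ)] →
          z' ∈ sector k (2 * l - 1 + σ)) := by
  have hk0 : 0 < k := by omega
  have hp : p ≠ 0 := by
    rintro rfl
    rw [Int.natAbs_zero, Nat.gcd_zero_left] at hpk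
    omega
  have hcop : IsCoprime p (k : ℤ) := by
    rw [Int.isCoprime_iff_gcd_eq_one]
    exact hpk
  set G := powComp p k A A₀ a b c d
  obtain ⟨L, hLdef⟩ : ∃ L : ℂ → ℂ, ∀ u, L u = p * u + k * logGen A A₀ a b c d u :=
    ⟨_, fun _ => rfl⟩
  have hGL : ∀ u ∈ piStrip, ∀ m : ℤ, G (exp ((u + 2 * Real.pi * m * I) / k)) =
      exp ((L u + 2 * Real.pi * (m * p) * I) / k) := fun u hu m => by
    rw [hLdef]
    exact powComp_exp hk0 ha hb hc hd hsa hsb hsc hsd hu m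
  have hL : ∀ u ∈ piStrip, ∃ D, HasDerivAt L D u ∧ 0 < D.im := fun u hu => by
    obtain ⟨D, hD, hpos⟩ := hasDerivAt_logGen hA hA₀ ha hb hc hd hsa hsb hsc hsd
      (genFun_nontrivial hA hA₀ hG) hu
    refine ⟨p * 1 + k * D, ?_, ?_⟩
    · rw [funext hLdef]
      exact ((hasDerivAt_id u).const_mul (p : ℂ)).add (hD.const_mul (k : ℂ))
    · have : ((p : ℂ) * 1 + k * D).im = k * D.im := by simp
      rw [this]
      exact mul_pos (Nat.cast_pos.mpr hk0) hpos
  have hconj : ∀ z, G (starRingEnd ℂ z) = starRingEnd ℂ (G z) := powComp_conj p k A A₀ a b c d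
  have hreal : ∀ z : ℂ, (z ^ k).im = 0 → (G z ^ k).im = 0 := fun z =>
    powComp_pow_im_eq_zero p k A A₀ a b c d
  have hα0 : α ≠ 0 := by
    rintro rfl
    rw [zero_pow hk0.ne', zero_im] at hα
    exact hα rfl
  have him : ∀ z, G z = α → (z ^ k).im ≠ 0 := fun z hz h => hα (hz ▸ hreal z h)
  refine ⟨fun z hz => ⟨?_, him z hz, fun z' hz' hn => ?_⟩, ?_⟩
  · have hz0 : G z = α := hz
    rw [← hz0]
    exact isSimpleAlphaPoint_of_im_ne_zero hk0 hGL hconj hL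
      (fun w hw => analyticAt_powComp hp hsa hsb hsc hsd hw) (him z hz) (hz0 ▸ hα0)
  · exact eq_of_norm_eq hk0 hcop hGL hconj hL (fun w w' => powComp_pow_eq) hα hz hz' hn
      (him z hz) (him z' hz')
  · intro z z' hzz q m ϰ σ _ hσ hαs hzs
    exact sector_of_consecutive hk0 hcop hGL hconj hreal hL
      (fun u hu v hv huv s h1 h2 hs => exists_mem_level_logGen hLdef ha hb hc hd hsa hsb hsc hsd hL
        hu hv huv h1 h2 hs) hα hzz hσ hαs hzs
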